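/- Consider the following game between Forecaster, Skeptic and Reality (the simplified predictably unbounded forecasting game) with initial capital $\mathcal K_0=\alpha>0$. In each round $n=1,2,\dots$, Forecaster announces $c_n\ge 0$, then Skeptic announces $M_n\in\mathbb R$, then Reality announces $x_n\in[-c_n,c_n]$, and Skeptic's capital becomes $\mathcal K_n=\mathcal K_{n-1}+M_nx_n$. A strategy of Skeptic determines $M_n$ as a function of $c_1,x_1,\dots,c_{n-1},x_{n-1},c_n$. Skeptic *can force* an event $E$ (a property of the path $(c_1,x_1,c_2,x_2,\dots)$) if he has a strategy such that $\mathcal K_n\ge 0$ for all $n$ on every path, and $\mathcal K_n\to\infty$ on every path on which $E$ fails. Put $S_n=\sum_{i=1}^n x_i$, $A_n^2=\sum_{i=1}^n x_i^2$ and $A_n=\sqrt{A_n^2}$. Let $\psi:[1,\infty)\to(0,\infty)$ be a non-decreasing continuous function and let $$I(\psi)=\int_1^\infty \psi(\lambda)\,e^{-\psi(\lambda)^2/2}\,\frac{d\lambda}{\lambda}\in[0,\infty].$$ **Theorem.** Let $\alpha>0$. (1) If $I(\psi)<\infty$, then Skeptic can force $$A_n^2\to\infty\ \text{ and }\ \limsup_{n\to\infty}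 c_n\frac{\psi(A_n^2)^3}{A_n}<\infty\quad\Longrightarrow\quad S_n<A_n\psi(A_n^2)\ \text{ for all sufficiently large } n.$$ (2) If $I(\psi)=\infty$ and $\psi(\lambda)\to\infty$ as $\lambda\to\infty$, then Skeptic can force $$A_n^2\to\infty\ \text{ and }\ \limsup_{n\to\infty} c_n\frac{\psi(A_n^2)^3}{A_n}<\infty\quad\Longrightarrow\quad S_n\ge A_n\psi(A_n^2)\ \text{ for infinitely many } n.$$ -/

import Mathlib

/-! The simplified predictably unbounded forecasting game. Rounds are indexed from `0`:
round number `n + 1` of the protocol is the round with index `n`. -/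

namespace SPUFG

/-- A path of the game: the moves `c` of Forecaster and the moves `x` of Reality, where
Forecaster must play `c n ≥ 0` and Reality must play `x n ∈ [-c n, c n]`. -/
structure Path where
  /-- the moves of Forecaster -/
  c : ℕ → ℝ
  /-- the moves of Reality -/
  x : ℕ → ℝ
  c_nonneg : ∀ n, 0 ≤ c n
  x_mem : ∀ n, x n ∈ Set.Icc (-c n) (c n)

/-- A strategy for Skeptic: his move in round `n` is a function of the moves of Forecaster and
Reality in the earlier rounds and of the move that Forecaster has just announced. -/
def Strategy : Type := (n : ℕ) → (Fin n → ℝ × ℝ) → ℝ → ℝ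

/-- The move of Skeptic in round `n` on the path `ω`, when he follows the strategy `P`. -/
def Strategy.move (P : Strategy) (ω : Path) (n : ℕ) : ℝ :=
  P n (fun i => (ω.c i, ω.x i)) (ω.c n)

/-- The capital of Skeptic after `n` rounds on the path `ω`, when he starts with capital `α`
and follows the strategy `P`. -/
noncomputable def Strategy.capital (P : Strategy) (α : ℝ) (ω : Path) : ℕ → ℝ
  | 0 => α
  | n + 1 => P.capital α ω n + P.move ω n * ω.x n

/-- Starting with capital `α`, Skeptic can force the event `E`: he has a strategy that never
lets his capital become negative, whatever the path, and that makes his capital tend to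
infinity on every path on which `E` fails. -/
def CanForce (α : ℝ) (E : Path → Prop) : Prop :=
  ∃ P : Strategy, ∀ ω : Path,
    (∀ n, 0 ≤ P.capital α ω n) ∧
    (¬ E ω → Filter.Tendsto (P.capital α ω) Filter.atTop Filter.atTop)

/-- `S_n`, the sum of the first `n` moves of Reality. -/
noncomputable def Path.S (ω : Path) (n : ℕ) : ℝ := ∑ i ∈ Finset.range n, ω.x i

/-- `A_n ^ 2`, the sum of the squares of the first `n` moves of Reality. -/
noncomputable def Path.Asq (ω : Path) (n : ℕ) : ℝ := ∑ i ∈ Finset.range n, ω.x i ^ 2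

/-- `A_n`, the nonnegative square root of `A_n ^ 2`. -/
noncomputable def Path.A (ω : Path) (n : ℕ) : ℝ := √(ω.Asq n)

/-- `A_n ^ 2` tends to infinity and `limsup c_n ψ(A_n ^ 2) ^ 3 / A_n < ∞`. (The move with index
`n` belongs to round number `n + 1`, so that it goes together with `A_{n+1}`.) -/
def Regular (ψ : ℝ → ℝ) (ω : Path) : Prop :=
  Filter.Tendsto ω.Asq Filter.atTop Filter.atTop ∧
  Filter.limsup
    (fun n : ℕ => ((ω.c n * (ψ (ω.Asq (n + 1)) ^ 3 / ω.A (n + 1)) : ℝ) : EReal))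
    Filter.atTop < ⊤

/-- `I(ψ) = ∫_1^∞ ψ(t) exp(-ψ(t)^2/2) dt/t`, as an element of `[0, ∞]`. -/
noncomputable def integralI (ψ : ℝ → ℝ) : ENNReal :=
  ∫⁻ t in Set.Ici (1 : ℝ), ENNReal.ofReal (ψ t * Real.exp (-(ψ t) ^ 2 / 2) / t)

end SPUFG

/-! For a small rate `g`, the capital `∏ (1 + g xᵢ)` is close to `exp (g S - g² A² / 2)`; as a
function of `g` this is largest at `g = S / A²`. Cut the range of `A²` into the levels `m` on which
`m ≤ ψ² < m + 1`, and measure each of them on the logarithmic scale; then `I(ψ)` and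
`∑ m, (length of level m) √m e^{-m/2}` are finite or infinite together.

If the sum is finite, Skeptic can afford to put capital of order `√m e^{-m/2}`, per unit of
length, on the rates suited to level `m`, on a grid of mesh of order `1 / √m`. When
`S ≥ A ψ(A²)`, the rates of the nearby grid points have multiplied their shares by about
`e^{m/2}`, and coefficients that increase slowly to infinity turn this into unbounded capital.

If the sum is infinite, Skeptic sells such a mixture, in disjoint cycles on the logarithmic scale
whose length at level `m` is of order `√m`. As long as `S < A ψ(A²)`, what he owes stays below
what he received, up to a factor, and over a completed cycle almost all of the sold capital
vanishes, so he keeps a fixed part of its price. The prices add up to infinity, and only the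
cycle under way has to be covered. -/

namespace SPUFG

open Filter Topology MeasureTheory

lemma Path.abs_x_le (ω : Path) (n : ℕ) : |ω.x n| ≤ ω.c n :=
  abs_le.2 (ω.x_mem n)

lemma Path.sq_x_le (ω : Path) (n : ℕ) : ω.x n ^ 2 ≤ ω.c n ^ 2 :=
  sq_le_sq' (ω.x_mem n).1 (ω.x_mem n).2

lemma Path.abs_mul_x_le (ω : Path) (r : ℝ) (n : ℕ) : |r * ω.x n| ≤ |r| * ω.c n := by
  rw [abs_mul]
  exact mul_le_mul_of_nonneg_left (ω.abs_x_le n) (abs_nonneg r)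

lemma Path.Asq_succ (ω : Path) (n : ℕ) : ω.Asq (n + 1) = ω.Asq n + ω.x n ^ 2 :=
  Finset.sum_range_succ _ _

lemma Path.Asq_nonneg (ω : Path) (n : ℕ) : 0 ≤ ω.Asq n :=
  Finset.sum_nonneg fun _ _ => sq_nonneg _

lemma Path.Asq_mono (ω : Path) : Monotone ω.Asq :=
  monotone_nat_of_le_succ fun n => by
    rw [ω.Asq_succ]
    exact le_add_of_nonneg_right (sq_nonneg _)

lemma Path.A_sq (ω : Path) (n : ℕ) : ω.A n ^ 2 = ω.Asq n :=
  Real.sq_sqrt (ω.Asq_nonneg n)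

/-! ### Predictable bets and their capital -/

/-- The paths `ω` and `ω'` agree in the first `n` rounds. -/
def Path.Agree (n : ℕ) (ω ω' : Path) : Prop :=
  ∀ i < n, ω.c i = ω'.c i ∧ ω.x i = ω'.x i

lemma Path.Agree.mono {m n : ℕ} {ω ω' : Path} (h : Path.Agree n ω ω') (hmn : m ≤ n) :
    Path.Agree m ω ω' :=
  fun i hi => h i (hi.trans_le hmn)

/-- A process is adapted if its value at time `n` is determined by the first `n` rounds. -/
def Adapted (K : Path → ℕ → ℝ) : Prop :=
  ∀ n ω ω', Path.Agree n ω ω' → K ω n = K ω' n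

/-- A process is predictable if its value at `n` is determined by the first `n` rounds together
with Forecaster's next move. The bets that a strategy of Skeptic can make are exactly the
predictable processes, which are easier to handle than the strategies themselves. -/
def Predictable (p : Path → ℕ → ℝ) : Prop :=
  ∀ n ω ω', Path.Agree n ω ω' → ω.c n = ω'.c n → p ω n = p ω' n

lemma adapted_Asq : Adapted Path.Asq := fun _ _ _ h =>
  Finset.sum_congr rfl fun i hi => by rw [(h i (Finset.mem_range.1 hi)).2]

/-- The capital after `n` rounds, with initial capital `K₀` and bets `p`. -/
noncomputable def wealth (K₀ : ℝ) (p : Path → ℕ → ℝ) (ω : Path) (n : ℕ) : ℝ :=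
  K₀ + ∑ i ∈ Finset.range n, p ω i * ω.x i

lemma wealth_zero (K₀ : ℝ) (p : Path → ℕ → ℝ) (ω : Path) : wealth K₀ p ω 0 = K₀ := by
  simp [wealth]

lemma wealth_succ (K₀ : ℝ) (p : Path → ℕ → ℝ) (ω : Path) (n : ℕ) :
    wealth K₀ p ω (n + 1) = wealth K₀ p ω n + p ω n * ω.x n := by
  simp [wealth, Finset.sum_range_succ, add_assoc]

lemma Predictable.adapted_wealth {p : Path → ℕ → ℝ} (hp : Predictable p) (K₀ : ℝ) :
    Adapted (wealth K₀ p) := fun n ω ω' h => by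
  refine congrArg (K₀ + ·) (Finset.sum_congr rfl fun i hi => ?_)
  have hin := Finset.mem_range.1 hi
  rw [hp i ω ω' (h.mono hin.le) (h i hin).1, (h i hin).2]

lemma Predictable.exists_strategy {p : Path → ℕ → ℝ} (hp : Predictable p) :
    ∃ P : Strategy, ∀ α ω n, P.capital α ω n = wealth α p ω n := by
  classical
  -- A history is continued to some path; by predictability the choice is immaterial.
  let P : Strategy := fun n h c =>
    if H : ∃ ω : Path, (∀ i : Fin n, (ω.c i, ω.x i) = h i) ∧ ω.c n = c then p H.choose n else 0
  have move_eq (ω : Path) (n : ℕ) : P.move ω n = p ω n := by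
    have H : ∃ ω' : Path, (∀ i : Fin n, (ω'.c i, ω'.x i) = (ω.c i, ω.x i)) ∧ ω'.c n = ω.c n :=
      ⟨ω, fun _ => rfl, rfl⟩
    calc P.move ω n = p H.choose n := dif_pos H
      _ = p ω n := hp n _ _ (fun i hi => Prod.mk.inj (H.choose_spec.1 ⟨i, hi⟩)) H.choose_spec.2
  refine ⟨P, fun α ω n => ?_⟩
  induction n with
  | zero => rw [wealth_zero]; rfl
  | succ n ih => rw [wealth_succ, ← ih, ← move_eq]; rfl

/-- The bet in round `n` cannot make the capital negative, whatever Reality's move is. -/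
def PrudentAt (K₀ : ℝ) (p : Path → ℕ → ℝ) (ω : Path) (n : ℕ) : Prop :=
  |p ω n| * ω.c n ≤ wealth K₀ p ω n

/-- Bets that never risk more than the current capital. -/
def Prudent (K₀ : ℝ) (p : Path → ℕ → ℝ) : Prop :=
  ∀ ω n, PrudentAt K₀ p ω n

lemma PrudentAt.nonneg_succ {K₀ : ℝ} {p : Path → ℕ → ℝ} {ω : Path} {n : ℕ}
    (h : PrudentAt K₀ p ω n) : 0 ≤ wealth K₀ p ω (n + 1) := by
  rw [wealth_succ]
  linarith [(abs_le.1 (ω.abs_mul_x_le (p ω n) n)).1, show _ ≤ _ from h]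

lemma Prudent.nonneg {K₀ : ℝ} {p : Path → ℕ → ℝ} (h : Prudent K₀ p) (ω : Path) (n : ℕ) :
    0 ≤ wealth K₀ p ω n :=
  (mul_nonneg (abs_nonneg _) (ω.c_nonneg n)).trans (h ω n)

lemma Prudent.wealth_le_mul_two_pow {K₀ : ℝ} {p : Path → ℕ → ℝ} (h : Prudent K₀ p) (ω : Path)
    (n : ℕ) : wealth K₀ p ω n ≤ K₀ * 2 ^ n := by
  induction n with
  | zero => simp [wealth_zero]
  | succ n ih =>
    rw [wealth_succ, pow_succ]
    linarith [(abs_le.1 (ω.abs_mul_x_le (p ω n) n)).2, show _ ≤ _ from h ω n]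

/-! ### Stopping a bet -/

section Stopping

/-- Up to and including round `n`, every bet is prudent and the target `T` is not yet reached. -/
def Active (K₀ T : ℝ) (p : Path → ℕ → ℝ) (ω : Path) (n : ℕ) : Prop :=
  ∀ i ≤ n, PrudentAt K₀ p ω i ∧ wealth K₀ p ω i < T

open Classical in
/-- The bets `p`, stopped when the target `T` has been reached or when the next bet would not be
prudent. -/
noncomputable def stopped (K₀ T : ℝ) (p : Path → ℕ → ℝ) (ω : Path) (n : ℕ) : ℝ :=
  if Active K₀ T p ω n then p ω n else 0

variable {K₀ T : ℝ} {p : Path → ℕ → ℝ} {ω : Path} {m n : ℕ}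

lemma Active.anti (h : Active K₀ T p ω n) (hmn : m ≤ n) : Active K₀ T p ω m :=
  fun i hi => h i (hi.trans hmn)

lemma Predictable.active_congr (hp : Predictable p) {ω' : Path} (h : Path.Agree n ω ω')
    (hc : ω.c n = ω'.c n) : Active K₀ T p ω n ↔ Active K₀ T p ω' n := by
  refine forall₂_congr fun i hi => ?_
  have hci : ω.c i = ω'.c i := by
    rcases hi.lt_or_eq with hlt | rfl
    · exact (h i hlt).1
    · exact hc
  rw [PrudentAt, PrudentAt, hp.adapted_wealth K₀ i ω ω' (h.mono hi),
    hp i ω ω' (h.mono hi) hci, hci]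

lemma Predictable.stopped (hp : Predictable p) : Predictable (stopped K₀ T p) :=
  fun n ω ω' h hc => by
    classical exact if_congr (hp.active_congr h hc) (hp n ω ω' h hc) rfl

lemma wealth_stopped_of_active (h : ∀ i < n, Active K₀ T p ω i) :
    wealth K₀ (stopped K₀ T p) ω n = wealth K₀ p ω n :=
  congrArg (K₀ + ·) (Finset.sum_congr rfl fun i hi => by
    rw [stopped, if_pos (h i (Finset.mem_range.1 hi))])

lemma Active.prudentAt_stopped (h : Active K₀ T p ω n) :
    PrudentAt K₀ (stopped K₀ T p) ω n := by
  rw [PrudentAt, wealth_stopped_of_active fun i hi => h.anti hi.le, stopped, if_pos h]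
  exact (h n le_rfl).1

lemma wealth_stopped_nonneg (hK₀ : 0 ≤ K₀) (p : Path → ℕ → ℝ) (ω : Path) (n : ℕ) :
    0 ≤ wealth K₀ (stopped K₀ T p) ω n := by
  induction n with
  | zero => rwa [wealth_zero]
  | succ n ih =>
    by_cases h : Active K₀ T p ω n
    · exact h.prudentAt_stopped.nonneg_succ
    · rwa [wealth_succ, stopped, if_neg h, zero_mul, add_zero]

lemma prudent_stopped (hK₀ : 0 ≤ K₀) (p : Path → ℕ → ℝ) : Prudent K₀ (stopped K₀ T p) := by
  intro ω n
  by_cases h : Active K₀ T p ω n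
  · exact h.prudentAt_stopped
  · rw [PrudentAt, stopped, if_neg h, abs_zero, zero_mul]
    exact wealth_stopped_nonneg hK₀ p ω n

lemma le_wealth_stopped (hT : T ≤ wealth K₀ p ω n) (hp : ∀ i < n, PrudentAt K₀ p ω i)
    (hnm : n ≤ m) : T ≤ wealth K₀ (stopped K₀ T p) ω m := by
  classical
  have hex : ∃ n, T ≤ wealth K₀ p ω n := ⟨n, hT⟩
  set hit := Nat.find hex
  have hitn : hit ≤ n := Nat.find_min' hex hT
  have active_of_lt : ∀ i < hit, Active K₀ T p ω i := fun i hi j hj =>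
    ⟨hp j (by lia), not_le.1 (Nat.find_min hex (hj.trans_lt hi))⟩
  have hitm := hitn.trans hnm
  clear hnm
  induction m, hitm using Nat.le_induction with
  | base => rw [wealth_stopped_of_active active_of_lt]; exact Nat.find_spec hex
  | succ m hm ih =>
    have hnot : ¬ Active K₀ T p ω m := fun h => (h hit hm).2.not_ge (Nat.find_spec hex)
    rwa [wealth_succ, stopped, if_neg hnot, zero_mul, add_zero]

end Stopping

/-! ### Forcing events -/

lemma CanForce.mono {α : ℝ} {E F : Path → Prop} (h : CanForce α E) (hEF : ∀ ω, E ω → F ω) :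
    CanForce α F := by
  obtain ⟨P, hP⟩ := h
  exact ⟨P, fun ω => ⟨(hP ω).1, fun hF => (hP ω).2 fun hE => hF (hEF ω hE)⟩⟩

lemma Strategy.capital_add (P Q : Strategy) (α β : ℝ) (ω : Path) (n : ℕ) :
    Strategy.capital (fun n h c => P n h c + Q n h c) (α + β) ω n =
      P.capital α ω n + Q.capital β ω n := by
  induction n with
  | zero => rfl
  | succ n ih =>
    simp only [Strategy.capital, ih, Strategy.move]
    ring

lemma CanForce.and {α β : ℝ} {E F : Path → Prop} (hE : CanForce α E) (hF : CanForce β F) :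
    CanForce (α + β) (fun ω => E ω ∧ F ω) := by
  obtain ⟨P, hP⟩ := hE
  obtain ⟨Q, hQ⟩ := hF
  refine ⟨fun n h c => P n h c + Q n h c, fun ω => ⟨fun n => ?_, fun h => ?_⟩⟩
  · rw [Strategy.capital_add]
    exact add_nonneg ((hP ω).1 n) ((hQ ω).1 n)
  · rw [funext (Strategy.capital_add P Q α β ω)]
    by_cases hE : E ω
    · exact tendsto_atTop_add_left_of_le _ 0 (hP ω).1 ((hQ ω).2 fun hF => h ⟨hE, hF⟩)
    · exact tendsto_atTop_add_right_of_le _ 0 ((hP ω).2 hE) (hQ ω).1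

lemma summable_mul_wealth {q : ℕ → Path → ℕ → ℝ} (hq : ∀ k, Prudent 1 (q k)) {a : ℕ → ℝ}
    (ha : ∀ k, 0 ≤ a k) (hs : Summable a) (ω : Path) (n : ℕ) :
    Summable (fun k => a k * wealth 1 (q k) ω n) := by
  refine Summable.of_nonneg_of_le (fun k => mul_nonneg (ha k) ((hq k).nonneg ω n))
    (fun k => mul_le_mul_of_nonneg_left ?_ (ha k)) (hs.mul_right (2 ^ n))
  simpa using (hq k).wealth_le_mul_two_pow ω n

lemma wealth_tsum {q : ℕ → Path → ℕ → ℝ} (hq : ∀ k, Prudent 1 (q k)) {a : ℕ → ℝ}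
    (ha : ∀ k, 0 ≤ a k) (hs : Summable a) (ω : Path) (n : ℕ) :
    wealth (∑' k, a k) (fun ω n => ∑' k, a k * q k ω n) ω n =
      ∑' k, a k * wealth 1 (q k) ω n := by
  induction n with
  | zero => simp [wealth_zero]
  | succ n ih =>
    have hsum := summable_mul_wealth hq ha hs ω n
    have summable_gain : Summable (fun k => a k * (q k ω n * ω.x n)) := by
      refine Summable.of_norm_bounded hsum fun k => ?_
      rw [Real.norm_eq_abs, abs_mul, abs_of_nonneg (ha k)]
      exact mul_le_mul_of_nonneg_left ((ω.abs_mul_x_le _ n).trans (hq k ω n)) (ha k)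
    simp only [wealth_succ, mul_add]
    rw [ih, hsum.tsum_add summable_gain, ← tsum_mul_right]
    simp only [mul_assoc]

/-- From the initial capital `1`, the bets `p` reach the target `T` on the path `ω`, and they are
prudent until then. -/
def Reaches (T : ℝ) (p : Path → ℕ → ℝ) (ω : Path) : Prop :=
  ∃ n, T ≤ wealth 1 p ω n ∧ ∀ i < n, PrudentAt 1 p ω i

lemma Reaches.mono {T T' : ℝ} {p : Path → ℕ → ℝ} {ω : Path} (h : Reaches T p ω) (hT : T' ≤ T) :
    Reaches T' p ω :=
  h.imp fun _ hn => ⟨hT.trans hn.1, hn.2⟩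

theorem canForce_of_frequently_reaches {α : ℝ} (hα : 0 < α) {E : Path → Prop}
    {p : ℕ → Path → ℕ → ℝ} (hp : ∀ k, Predictable (p k)) {v T : ℕ → ℝ} (hv : ∀ k, 0 < v k)
    (hs : Summable v) (hvT : Tendsto (fun k => v k * T k) atTop atTop)
    (h : ∀ ω, ¬ E ω → ∃ᶠ k in atTop, Reaches (T k) (p k) ω) : CanForce α E := by
  -- Divide the capital among the stopped bets in proportion to `v`.
  set r : ℝ := α / ∑' k, v k with hr
  have tsum_pos : 0 < ∑' k, v k := hs.tsum_pos (fun k => (hv k).le) 0 (hv 0)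
  have hr0 : 0 < r := div_pos hα tsum_pos
  have hrv (k : ℕ) : 0 ≤ r * v k := (mul_pos hr0 (hv k)).le
  have hq (k : ℕ) : Prudent 1 (stopped 1 (T k) (p k)) := prudent_stopped zero_le_one (p k)
  have predictable : Predictable (fun ω n => ∑' k, r * v k * stopped 1 (T k) (p k) ω n) :=
    fun n ω ω' hag hc => tsum_congr fun k => by rw [(hp k).stopped n ω ω' hag hc]
  obtain ⟨P, hP⟩ := predictable.exists_strategy
  have capital_eq (ω : Path) (n : ℕ) :
      P.capital α ω n = ∑' k, r * v k * wealth 1 (stopped 1 (T k) (p k)) ω n := by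
    have tsum_eq : ∑' k, r * v k = α := by rw [tsum_mul_left, hr, div_mul_cancel₀ _ tsum_pos.ne']
    rw [hP, ← wealth_tsum hq hrv (hs.mul_left r), tsum_eq]
  have term_nonneg (ω : Path) (n k : ℕ) :
      0 ≤ r * v k * wealth 1 (stopped 1 (T k) (p k)) ω n :=
    mul_nonneg (hrv k) ((hq k).nonneg ω n)
  refine ⟨P, fun ω => ⟨fun n => capital_eq ω n ▸ tsum_nonneg (term_nonneg ω n), fun hE => ?_⟩⟩
  refine tendsto_atTop.2 fun B => ?_
  obtain ⟨k, ⟨n, hTn, hpn⟩, hBk⟩ :=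
    ((h ω hE).and_eventually ((hvT.const_mul_atTop hr0).eventually_ge_atTop B)).exists
  filter_upwards [eventually_ge_atTop n] with j hnj
  calc B ≤ r * v k * T k := by rwa [mul_assoc]
    _ ≤ r * v k * wealth 1 (stopped 1 (T k) (p k)) ω j :=
        mul_le_mul_of_nonneg_left (le_wealth_stopped hTn hpn hnj) (hrv k)
    _ ≤ P.capital α ω j := by
        rw [capital_eq]
        exact (summable_mul_wealth hq hrv (hs.mul_left r) ω j).le_tsum k
          fun i _ => term_nonneg ω j i

/-! ### Mixtures of bets -/

section Mixture

variable {ι : Type*} {s : Finset ι} {p : ι → Path → ℕ → ℝ}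

/-- The linear combination of the bets `p k` with the weights `θ k`. -/
noncomputable def mixtureBet (s : Finset ι) (θ : ι → ℝ) (p : ι → Path → ℕ → ℝ) (ω : Path)
    (n : ℕ) : ℝ :=
  ∑ k ∈ s, θ k * p k ω n

/-- The equally weighted mixture of the bets `p k`. -/
noncomputable def averageBet (s : Finset ι) (p : ι → Path → ℕ → ℝ) : Path → ℕ → ℝ :=
  mixtureBet s (fun _ => (s.card : ℝ)⁻¹) p

lemma Predictable.mixtureBet {θ : ι → ℝ} (hp : ∀ k, Predictable (p k)) :
    Predictable (mixtureBet s θ p) := fun n ω ω' h hc =>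
  Finset.sum_congr rfl fun k _ => by rw [hp k n ω ω' h hc]

lemma Predictable.averageBet (hp : ∀ k, Predictable (p k)) : Predictable (averageBet s p) :=
  Predictable.mixtureBet hp

lemma wealth_mixtureBet (s : Finset ι) (θ : ι → ℝ) (p : ι → Path → ℕ → ℝ) (ω : Path) (n : ℕ) :
    wealth 1 (mixtureBet s θ p) ω n = 1 + ∑ k ∈ s, θ k * (wealth 1 (p k) ω n - 1) := by
  induction n with
  | zero => simp [wealth_zero]
  | succ n ih =>
    rw [wealth_succ, ih, mixtureBet, Finset.sum_mul, add_assoc, ← Finset.sum_add_distrib]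
    simp only [wealth_succ]
    exact congrArg (1 + ·) (Finset.sum_congr rfl fun k _ => by ring)

lemma abs_mixtureBet_mul_c_le (s : Finset ι) (θ : ι → ℝ) (p : ι → Path → ℕ → ℝ) (ω : Path)
    (n : ℕ) : |mixtureBet s θ p ω n| * ω.c n ≤ ∑ k ∈ s, |θ k| * (|p k ω n| * ω.c n) :=
  calc |mixtureBet s θ p ω n| * ω.c n ≤ (∑ k ∈ s, |θ k * p k ω n|) * ω.c n :=
        mul_le_mul_of_nonneg_right (Finset.abs_sum_le_sum_abs _ _) (ω.c_nonneg n)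
    _ = ∑ k ∈ s, |θ k| * (|p k ω n| * ω.c n) := by simp only [Finset.sum_mul, abs_mul, mul_assoc]

lemma wealth_averageBet (hs : s.Nonempty) (p : ι → Path → ℕ → ℝ) (ω : Path) (n : ℕ) :
    wealth 1 (averageBet s p) ω n = (s.card : ℝ)⁻¹ * ∑ k ∈ s, wealth 1 (p k) ω n := by
  have card_ne_zero : (s.card : ℝ) ≠ 0 := Nat.cast_ne_zero.2 hs.card_ne_zero
  rw [averageBet, wealth_mixtureBet, ← Finset.mul_sum, Finset.sum_sub_distrib, Finset.sum_const,
    nsmul_one, mul_sub, inv_mul_cancel₀ card_ne_zero, add_sub_cancel]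

lemma prudent_averageBet (hs : s.Nonempty) (hp : ∀ k, Prudent 1 (p k)) :
    Prudent 1 (averageBet s p) := fun ω n => by
  rw [PrudentAt, wealth_averageBet hs, Finset.mul_sum]
  refine (abs_mixtureBet_mul_c_le _ _ _ _ _).trans (Finset.sum_le_sum fun k _ => ?_)
  rw [abs_of_nonneg (by positivity)]
  exact mul_le_mul_of_nonneg_left (hp k ω n) (by positivity)

lemma inv_card_mul_wealth_le_averageBet (hp : ∀ k, Prudent 1 (p k)) {k : ι} (hk : k ∈ s)
    (ω : Path) (n : ℕ) :
    (s.card : ℝ)⁻¹ * wealth 1 (p k) ω n ≤ wealth 1 (averageBet s p) ω n := by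
  rw [wealth_averageBet ⟨k, hk⟩]
  exact mul_le_mul_of_nonneg_left
    (Finset.single_le_sum (fun j _ => (hp j).nonneg ω n) hk) (by positivity)

end Mixture

/-! ### Exponential capitals -/

lemma abs_log_one_add_sub_le {y : ℝ} (hy : |y| ≤ 1 / 2) :
    |Real.log (1 + y) - (y - y ^ 2 / 2)| ≤ 2 * |y| ^ 3 := by
  have taylor := Real.abs_log_sub_add_sum_range_le (x := -y) (by rw [abs_neg]; linarith) 2
  rw [abs_neg] at taylor
  norm_num [Finset.sum_range_succ] at taylor
  calc |Real.log (1 + y) - (y - y ^ 2 / 2)| = |-y + y ^ 2 / 2 + Real.log (1 + y)| := by ring_nf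
    _ ≤ |y| ^ 3 / (1 - |y|) := taylor
    _ ≤ 2 * |y| ^ 3 := by
      rw [div_le_iff₀ (by linarith)]
      nlinarith [pow_nonneg (abs_nonneg y) 3]

lemma exp_le_one_add {y : ℝ} (hy : |y| ≤ 1 / 2) :
    Real.exp (y - y ^ 2 / 2 - 2 * |y| ^ 3) ≤ 1 + y := by
  rw [← Real.le_log_iff_exp_le (by linarith [(abs_le.1 hy).1])]
  linarith [(abs_le.1 (abs_log_one_add_sub_le hy)).1]

lemma one_add_le_exp {y : ℝ} (hy : |y| ≤ 1 / 2) :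
    1 + y ≤ Real.exp (y - y ^ 2 / 2 + 2 * |y| ^ 3) := by
  rw [← Real.log_le_iff_le_exp (by linarith [(abs_le.1 hy).1])]
  linarith [(abs_le.1 (abs_log_one_add_sub_le hy)).2]

section ExpCapital

variable {γ a b : ℝ} {ω : Path} {n : ℕ}

open Classical in
/-- The fraction `γ` of the capital, staked while `A²` lies in `[a, b)` and only in rounds where
it is certain that the capital is not more than halved. -/
noncomputable def gatedFraction (γ a b : ℝ) (ω : Path) (i : ℕ) : ℝ :=
  if a ≤ ω.Asq i ∧ ω.Asq i < b ∧ |γ| * ω.c i ≤ 1 / 2 then γ else 0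

/-- The capital that starts from `1` and stakes the fraction `gatedFraction γ a b` in each round;
it behaves like `exp (γ S - γ² A² / 2)`. -/
noncomputable def expCapital (γ a b : ℝ) (ω : Path) (n : ℕ) : ℝ :=
  ∏ i ∈ Finset.range n, (1 + gatedFraction γ a b ω i * ω.x i)

/-- The bets whose capital is `expCapital γ a b`. -/
noncomputable def expBet (γ a b : ℝ) (ω : Path) (n : ℕ) : ℝ :=
  gatedFraction γ a b ω n * expCapital γ a b ω n

lemma predictable_gatedFraction (γ a b : ℝ) : Predictable (gatedFraction γ a b) :=
  fun n ω ω' h hc => by simp only [gatedFraction, adapted_Asq n ω ω' h, hc]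

lemma gatedFraction_eq_zero {i : ℕ} (h : ω.Asq i < a ∨ b ≤ ω.Asq i) :
    gatedFraction γ a b ω i = 0 :=
  if_neg fun h' => h.elim (fun hlt => hlt.not_ge h'.1) fun hle => hle.not_gt h'.2.1

lemma abs_gatedFraction_mul_c_le (γ a b : ℝ) (ω : Path) (i : ℕ) :
    |gatedFraction γ a b ω i| * ω.c i ≤ 1 / 2 := by
  unfold gatedFraction
  split_ifs with h
  · exact h.2.2
  · simp

lemma one_add_gatedFraction_mul_x_pos (γ a b : ℝ) (ω : Path) (i : ℕ) :
    0 < 1 + gatedFraction γ a b ω i * ω.x i := by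
  linarith [(abs_le.1 ((ω.abs_mul_x_le _ i).trans (abs_gatedFraction_mul_c_le γ a b ω i))).1]

lemma expCapital_pos (γ a b : ℝ) (ω : Path) (n : ℕ) : 0 < expCapital γ a b ω n :=
  Finset.prod_pos fun i _ => one_add_gatedFraction_mul_x_pos γ a b ω i

lemma predictable_expBet (γ a b : ℝ) : Predictable (expBet γ a b) := fun n ω ω' h hc => by
  have expCapital_eq : expCapital γ a b ω n = expCapital γ a b ω' n :=
    Finset.prod_congr rfl fun i hi => by
      have hin := Finset.mem_range.1 hi
      rw [predictable_gatedFraction γ a b i ω ω' (h.mono hin.le) (h i hin).1, (h i hin).2]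
  rw [expBet, expBet, predictable_gatedFraction γ a b n ω ω' h hc, expCapital_eq]

lemma wealth_expBet (γ a b : ℝ) (ω : Path) (n : ℕ) :
    wealth 1 (expBet γ a b) ω n = expCapital γ a b ω n := by
  induction n with
  | zero => simp [wealth_zero, expCapital]
  | succ n ih =>
    rw [wealth_succ, ih, expBet, expCapital, expCapital, Finset.prod_range_succ]
    ring

lemma abs_expBet_mul_c_le (γ a b : ℝ) (ω : Path) (n : ℕ) :
    |expBet γ a b ω n| * ω.c n ≤ expCapital γ a b ω n / 2 := by
  have hpos := expCapital_pos γ a b ω n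
  rw [expBet, abs_mul, abs_of_pos hpos, mul_right_comm]
  linarith [mul_le_mul_of_nonneg_right (abs_gatedFraction_mul_c_le γ a b ω n) hpos.le]

lemma prudent_expBet (γ a b : ℝ) : Prudent 1 (expBet γ a b) := fun ω n => by
  rw [PrudentAt, wealth_expBet]
  exact (abs_expBet_mul_c_le γ a b ω n).trans (half_le_self (expCapital_pos γ a b ω n).le)

lemma expBet_eq_zero (h : ω.Asq n < a ∨ b ≤ ω.Asq n) : expBet γ a b ω n = 0 := by
  rw [expBet, gatedFraction_eq_zero h, zero_mul]

lemma expCapital_eq_one (h : ω.Asq n < a) : expCapital γ a b ω n = 1 :=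
  Finset.prod_eq_one fun i hi => by
    have Asq_lt : ω.Asq i < a := (ω.Asq_mono (Finset.mem_range.1 hi).le).trans_lt h
    rw [gatedFraction_eq_zero (Or.inl Asq_lt), zero_mul, add_zero]

lemma Path.abs_mul_x_pow_three_le {η : ℝ} {i : ℕ} (h : |γ| * ω.c i ≤ η) :
    |γ * ω.x i| ^ 3 ≤ η * (γ * ω.x i) ^ 2 := by
  rw [pow_succ', sq_abs]
  exact mul_le_mul_of_nonneg_right ((ω.abs_mul_x_le γ i).trans h) (sq_nonneg _)

lemma exp_le_expCapital (hb : ∀ i < n, ω.Asq i < b) (hc : ∀ i < n, |γ| * ω.c i ≤ 1 / 2) :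
    Real.exp (γ * ω.S n - γ ^ 2 * ω.Asq n / 2 -
      ∑ i ∈ Finset.range n, 2 * (|γ| * ω.c i) * (γ ^ 2 * ω.x i ^ 2)) ≤
        expCapital γ 0 b ω n := by
  have exponent_eq : γ * ω.S n - γ ^ 2 * ω.Asq n / 2 -
      ∑ i ∈ Finset.range n, 2 * (|γ| * ω.c i) * (γ ^ 2 * ω.x i ^ 2) =
      ∑ i ∈ Finset.range n, (γ * ω.x i - γ ^ 2 * ω.x i ^ 2 / 2 -
        2 * (|γ| * ω.c i) * (γ ^ 2 * ω.x i ^ 2)) := by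
    simp only [Path.S, Path.Asq, Finset.sum_sub_distrib, Finset.mul_sum, Finset.sum_div]
  rw [exponent_eq, Real.exp_sum, expCapital]
  refine Finset.prod_le_prod (fun _ _ => (Real.exp_pos _).le) fun i hi => ?_
  have hin := Finset.mem_range.1 hi
  have fraction_eq : gatedFraction γ 0 b ω i = γ :=
    if_pos ⟨ω.Asq_nonneg i, hb i hin, hc i hin⟩
  have hy : |γ * ω.x i| ≤ 1 / 2 := (ω.abs_mul_x_le γ i).trans (hc i hin)
  rw [fraction_eq]
  refine le_trans (Real.exp_le_exp.2 ?_) (exp_le_one_add hy)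
  have cube_le := Path.abs_mul_x_pow_three_le (γ := γ) (ω := ω) (i := i) le_rfl
  rw [mul_pow] at cube_le ⊢
  linarith

lemma expCapital_eq_prod_Ico {n₁ n₂ : ℕ} (h2n : n₂ ≤ n) (h1 : ∀ i < n₁, ω.Asq i < a)
    (h2 : ∀ i, n₂ ≤ i → i < n → b ≤ ω.Asq i) :
    expCapital γ a b ω n = ∏ i ∈ Finset.Ico n₁ n₂, (1 + gatedFraction γ a b ω i * ω.x i) := by
  symm
  refine Finset.prod_subset (fun i hi => ?_) fun i hi hi' => ?_
  · exact Finset.mem_range.2 ((Finset.mem_Ico.1 hi).2.trans_le h2n)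
  · rw [Finset.mem_range] at hi
    rw [Finset.mem_Ico, not_and_or, not_le, not_lt] at hi'
    rw [gatedFraction_eq_zero (hi'.imp (h1 i) fun hle => h2 i hle hi), zero_mul, add_zero]

lemma expCapital_le_exp {η : ℝ} {n₁ n₂ : ℕ} (h12 : n₁ ≤ n₂) (h2n : n₂ ≤ n)
    (h1 : ∀ i < n₁, ω.Asq i < a) (h2 : ∀ i, n₂ ≤ i → i < n → b ≤ ω.Asq i)
    (hab : ∀ i, n₁ ≤ i → i < n₂ → a ≤ ω.Asq i ∧ ω.Asq i < b) (hη : η ≤ 1 / 2)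
    (hc : ∀ i, n₁ ≤ i → i < n₂ → |γ| * ω.c i ≤ η) :
    expCapital γ a b ω n ≤ Real.exp (γ * (ω.S n₂ - ω.S n₁) -
      γ ^ 2 * (1 / 2 - 2 * η) * (ω.Asq n₂ - ω.Asq n₁)) := by
  have S_sub : ω.S n₂ - ω.S n₁ = ∑ i ∈ Finset.Ico n₁ n₂, ω.x i :=
    (Finset.sum_Ico_eq_sub _ h12).symm
  have Asq_sub : ω.Asq n₂ - ω.Asq n₁ = ∑ i ∈ Finset.Ico n₁ n₂, ω.x i ^ 2 :=
    (Finset.sum_Ico_eq_sub _ h12).symm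
  rw [expCapital_eq_prod_Ico h2n h1 h2, S_sub, Asq_sub, Finset.mul_sum, Finset.mul_sum,
    ← Finset.sum_sub_distrib, Real.exp_sum]
  refine Finset.prod_le_prod (fun i _ => (one_add_gatedFraction_mul_x_pos γ a b ω i).le)
    fun i hi => ?_
  obtain ⟨hi1, hi2⟩ := Finset.mem_Ico.1 hi
  have hci := hc i hi1 hi2
  have fraction_eq : gatedFraction γ a b ω i = γ :=
    if_pos ⟨(hab i hi1 hi2).1, (hab i hi1 hi2).2, hci.trans hη⟩
  rw [fraction_eq]
  refine (one_add_le_exp ((ω.abs_mul_x_le γ i).trans (hci.trans hη))).trans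
    (Real.exp_le_exp.2 ?_)
  linarith [Path.abs_mul_x_pow_three_le hci, mul_pow γ (ω.x i) 2]

end ExpCapital

/-! ### Barriers and their thresholds -/

/-- A barrier: a positive, continuous, non-decreasing function on `[1, ∞)` that tends to `∞`. -/
structure IsBarrier (ψ : ℝ → ℝ) : Prop where
  continuousOn : ContinuousOn ψ (Set.Ici 1)
  monotoneOn : MonotoneOn ψ (Set.Ici 1)
  pos : ∀ t ∈ Set.Ici (1 : ℝ), 0 < ψ t
  tendsto : Tendsto ψ atTop atTop

/-- The first point of `[1, ∞)` at which `ψ ^ 2` reaches the level `m`. -/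
noncomputable def threshold (ψ : ℝ → ℝ) (m : ℕ) : ℝ :=
  sInf {t | 1 ≤ t ∧ (m : ℝ) ≤ ψ t ^ 2}

/-- The length of the interval on which `ψ ^ 2` lies in `[m, m + 1)`, on the logarithmic scale. -/
noncomputable def logLength (ψ : ℝ → ℝ) (m : ℕ) : ℝ :=
  Real.log (threshold ψ (m + 1)) - Real.log (threshold ψ m)

section Threshold

variable {ψ : ℝ → ℝ}

lemma bddBelow_threshold_set (ψ : ℝ → ℝ) (m : ℕ) :
    BddBelow {t : ℝ | 1 ≤ t ∧ (m : ℝ) ≤ ψ t ^ 2} :=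
  ⟨1, fun _ h => h.1⟩

lemma threshold_set_nonempty (hψ : Tendsto ψ atTop atTop) (m : ℕ) :
    {t : ℝ | 1 ≤ t ∧ (m : ℝ) ≤ ψ t ^ 2}.Nonempty :=
  ((eventually_ge_atTop (1 : ℝ)).and
    (((tendsto_pow_atTop two_ne_zero).comp hψ).eventually_ge_atTop (m : ℝ))).exists

lemma one_le_threshold (hψ : Tendsto ψ atTop atTop) (m : ℕ) : 1 ≤ threshold ψ m :=
  le_csInf (threshold_set_nonempty hψ m) fun _ h => h.1

lemma threshold_pos (hψ : Tendsto ψ atTop atTop) (m : ℕ) : 0 < threshold ψ m :=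
  one_pos.trans_le (one_le_threshold hψ m)

lemma threshold_mono (hψ : Tendsto ψ atTop atTop) : Monotone (threshold ψ) := fun m n hmn =>
  csInf_le_csInf (bddBelow_threshold_set ψ m) (threshold_set_nonempty hψ n) fun _ h =>
    ⟨h.1, (Nat.cast_le.2 hmn).trans h.2⟩

lemma threshold_zero (ψ : ℝ → ℝ) : threshold ψ 0 = 1 := by
  have set_eq : {t : ℝ | 1 ≤ t ∧ ((0 : ℕ) : ℝ) ≤ ψ t ^ 2} = Set.Ici 1 := by
    ext t; simp [sq_nonneg]
  rw [threshold, set_eq, csInf_Ici]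

lemma le_sqrt_of_lt_threshold {m : ℕ} {t : ℝ} (h1 : 1 ≤ t) (h : t < threshold ψ m) :
    ψ t ≤ √(m : ℝ) :=
  Real.le_sqrt_of_sq_le (not_lt.1 fun hm =>
    (csInf_le (bddBelow_threshold_set ψ m) ⟨h1, hm.le⟩).not_gt h)

lemma logLength_nonneg (hψ : Tendsto ψ atTop atTop) (m : ℕ) : 0 ≤ logLength ψ m :=
  sub_nonneg.2 (Real.log_le_log (threshold_pos hψ m) (threshold_mono hψ m.le_succ))

lemma log_threshold_eq_sum (ψ : ℝ → ℝ) (m : ℕ) :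
    Real.log (threshold ψ m) = ∑ j ∈ Finset.range m, logLength ψ j := by
  simp only [logLength]
  rw [Finset.sum_range_sub fun j => Real.log (threshold ψ j), threshold_zero, Real.log_one,
    sub_zero]

namespace IsBarrier

lemma sqrt_le_of_threshold_le (h : IsBarrier ψ) {m : ℕ} {t : ℝ} (ht : threshold ψ m ≤ t) :
    √(m : ℝ) ≤ ψ t := by
  have closed : IsClosed {t : ℝ | 1 ≤ t ∧ (m : ℝ) ≤ ψ t ^ 2} :=
    (h.continuousOn.pow 2).preimage_isClosed_of_isClosed isClosed_Ici
      (isClosed_Ici (a := (m : ℝ)))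
  have mem : 1 ≤ threshold ψ m ∧ (m : ℝ) ≤ ψ (threshold ψ m) ^ 2 :=
    closed.csInf_mem (threshold_set_nonempty h.tendsto m) (bddBelow_threshold_set ψ m)
  calc √(m : ℝ) ≤ ψ (threshold ψ m) := Real.sqrt_le_iff.2 ⟨(h.pos _ mem.1).le, mem.2⟩
    _ ≤ ψ t := h.monotoneOn mem.1 (mem.1.trans ht) ht

lemma tendsto_threshold (h : IsBarrier ψ) : Tendsto (threshold ψ) atTop atTop := by
  refine tendsto_atTop_atTop_of_monotone (threshold_mono h.tendsto) fun B => ?_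
  obtain ⟨m, hm⟩ :=
    ((Real.tendsto_sqrt_atTop.comp tendsto_natCast_atTop_atTop).eventually_gt_atTop (ψ B)).exists
  refine ⟨m, ?_⟩
  by_contra! hlt
  exact (h.sqrt_le_of_threshold_le hlt.le).not_gt hm

lemma iUnion_Ico_threshold (h : IsBarrier ψ) :
    ⋃ m, Set.Ico (threshold ψ m) (threshold ψ (m + 1)) = Set.Ici 1 := by
  rw [← threshold_zero ψ]
  simpa using iUnion_Ico_map_succ_eq_Ici (fun m => threshold_mono h.tendsto m.zero_le)
    (not_bddAbove_of_tendsto_atTop h.tendsto_threshold)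

end IsBarrier

end Threshold

section Integral

variable {ψ f : ℝ → ℝ} {a b κ : ℝ}

lemma setLIntegral_const_div (ha : 0 < a) (hab : a ≤ b) (hκ : 0 ≤ κ) :
    ∫⁻ t in Set.Ico a b, ENNReal.ofReal (κ / t) =
      ENNReal.ofReal (κ * (Real.log b - Real.log a)) := by
  have hb : 0 < b := ha.trans_le hab
  have integrable : IntegrableOn (fun t : ℝ => κ / t) (Set.Ioc a b) := by
    refine (ContinuousOn.integrableOn_Icc ?_).mono_set Set.Ioc_subset_Icc_self
    exact continuousOn_const.div continuousOn_id fun t ht => (ha.trans_le ht.1).ne'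
  have nonneg : 0 ≤ᵐ[volume.restrict (Set.Ioc a b)] fun t => κ / t :=
    (ae_restrict_iff' measurableSet_Ioc).2 (Eventually.of_forall fun t ht =>
      div_nonneg hκ (ha.trans ht.1).le)
  rw [setLIntegral_congr (Ico_ae_eq_Ioc (μ := volume)),
    ← ofReal_integral_eq_lintegral_ofReal integrable nonneg, ← intervalIntegral.integral_of_le hab]
  simp_rw [div_eq_mul_one_div κ]
  rw [intervalIntegral.integral_const_mul, integral_one_div_of_pos ha hb,
    Real.log_div hb.ne' ha.ne']

lemma ofReal_mul_log_sub_le_setLIntegral (ha : 0 < a) (hab : a ≤ b) (hκ : 0 ≤ κ)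
    (hf : ∀ t ∈ Set.Ico a b, κ ≤ f t) :
    ENNReal.ofReal (κ * (Real.log b - Real.log a)) ≤
      ∫⁻ t in Set.Ico a b, ENNReal.ofReal (f t / t) := by
  rw [← setLIntegral_const_div ha hab hκ]
  exact setLIntegral_mono' measurableSet_Ico fun t ht => ENNReal.ofReal_le_ofReal
    (div_le_div_of_nonneg_right (hf t ht) (ha.trans_le ht.1).le)

lemma setLIntegral_le_ofReal_mul_log_sub (ha : 0 < a) (hab : a ≤ b) (hκ : 0 ≤ κ)
    (hf : ∀ t ∈ Set.Ico a b, f t ≤ κ) :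
    ∫⁻ t in Set.Ico a b, ENNReal.ofReal (f t / t) ≤
      ENNReal.ofReal (κ * (Real.log b - Real.log a)) := by
  rw [← setLIntegral_const_div ha hab hκ]
  exact setLIntegral_mono' measurableSet_Ico fun t ht => ENNReal.ofReal_le_ofReal
    (div_le_div_of_nonneg_right (hf t ht) (ha.trans_le ht.1).le)

lemma integralI_eq_top_of_bounded (hmono : MonotoneOn ψ (Set.Ici 1))
    (hpos : ∀ t ∈ Set.Ici (1 : ℝ), 0 < ψ t) {B : ℝ} (hB : ∀ t ∈ Set.Ici (1 : ℝ), ψ t ≤ B) :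
    integralI ψ = ⊤ := by
  have pos_one : 0 < ψ 1 := hpos 1 (Set.mem_Ici.2 le_rfl)
  set κ := ψ 1 * Real.exp (-B ^ 2 / 2)
  have hκ : 0 < κ := mul_pos pos_one (Real.exp_pos _)
  have le_integrand : ∀ t ∈ Set.Ici (1 : ℝ), κ ≤ ψ t * Real.exp (-(ψ t) ^ 2 / 2) := by
    intro t ht
    have hle : ψ 1 ≤ ψ t := hmono (Set.mem_Ici.2 le_rfl) ht ht
    refine mul_le_mul hle (Real.exp_le_exp.2 ?_) (Real.exp_pos _).le (hpos t ht).le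
    linarith [pow_le_pow_left₀ (hpos t ht).le (hB t ht) 2]
  refine ENNReal.eq_top_of_forall_nnreal_le fun r => ?_
  calc (r : ENNReal)
      = ENNReal.ofReal (κ * (Real.log (Real.exp (r / κ)) - Real.log 1)) := by
        rw [Real.log_exp, Real.log_one, sub_zero, mul_div_cancel₀ _ hκ.ne',
          ENNReal.ofReal_coe_nnreal]
    _ ≤ ∫⁻ t in Set.Ico 1 (Real.exp (r / κ)),
          ENNReal.ofReal (ψ t * Real.exp (-(ψ t) ^ 2 / 2) / t) :=
        ofReal_mul_log_sub_le_setLIntegral one_pos (Real.one_le_exp (by positivity)) hκ.le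
          fun t ht => le_integrand t ht.1
    _ ≤ integralI ψ := lintegral_mono_set Set.Ico_subset_Ici_self

lemma tendsto_atTop_of_integralI_lt_top (hmono : MonotoneOn ψ (Set.Ici 1))
    (hpos : ∀ t ∈ Set.Ici (1 : ℝ), 0 < ψ t) (hI : integralI ψ < ⊤) :
    Tendsto ψ atTop atTop := by
  refine tendsto_atTop.2 fun B => ?_
  obtain ⟨t, ht, hBt⟩ : ∃ t ∈ Set.Ici (1 : ℝ), B < ψ t := by
    by_contra! hB
    exact hI.ne (integralI_eq_top_of_bounded hmono hpos hB)
  filter_upwards [eventually_ge_atTop t] with r hr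
  exact hBt.le.trans (hmono ht (le_trans ht hr) hr)

namespace IsBarrier

lemma integralI_eq_tsum (h : IsBarrier ψ) :
    integralI ψ = ∑' m, ∫⁻ t in Set.Ico (threshold ψ m) (threshold ψ (m + 1)),
      ENNReal.ofReal (ψ t * Real.exp (-(ψ t) ^ 2 / 2) / t) := by
  rw [integralI, ← h.iUnion_Ico_threshold]
  exact lintegral_iUnion (fun m => measurableSet_Ico)
    (by simpa [Nat.succ_eq_succ] using (threshold_mono h.tendsto).pairwise_disjoint_on_Ico_succ) _

lemma summable_of_integralI_lt_top (h : IsBarrier ψ) (hI : integralI ψ < ⊤) :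
    Summable fun m : ℕ => logLength ψ m * (√m * Real.exp (-m / 2)) := by
  have tsum_le : ∑' m : ℕ, ENNReal.ofReal (√m * Real.exp (-(m + 1) / 2) * logLength ψ m) ≤
      integralI ψ := by
    rw [h.integralI_eq_tsum]
    refine ENNReal.tsum_le_tsum fun m => ?_
    refine ofReal_mul_log_sub_le_setLIntegral (threshold_pos h.tendsto m)
      (threshold_mono h.tendsto m.le_succ) (by positivity) fun t ht => ?_
    have one_le := (one_le_threshold h.tendsto m).trans ht.1
    have psi_pos := h.pos t one_le
    have psi_sq_le : ψ t ^ 2 ≤ m + 1 := by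
      exact_mod_cast (Real.le_sqrt' psi_pos).1 (le_sqrt_of_lt_threshold one_le ht.2)
    refine mul_le_mul (h.sqrt_le_of_threshold_le ht.1) (Real.exp_le_exp.2 ?_)
      (Real.exp_pos _).le psi_pos.le
    linarith
  refine ((ENNReal.summable_toReal (tsum_le.trans_lt hI).ne).mul_left
    (Real.exp (1 / 2))).congr fun m => ?_
  have exp_eq : Real.exp (-(m : ℝ) / 2) = Real.exp (1 / 2) * Real.exp (-(m + 1) / 2) := by
    rw [← Real.exp_add]; ring_nf
  rw [ENNReal.toReal_ofReal (mul_nonneg (by positivity) (logLength_nonneg h.tendsto m)), exp_eq]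
  ring

lemma not_summable_of_integralI_eq_top (h : IsBarrier ψ) (hI : integralI ψ = ⊤) :
    ¬ Summable fun m : ℕ => √(m + 1) * Real.exp (-m / 2) * logLength ψ m := by
  intro hs
  have le_tsum : integralI ψ ≤
      ∑' m : ℕ, ENNReal.ofReal (√(m + 1) * Real.exp (-m / 2) * logLength ψ m) := by
    rw [h.integralI_eq_tsum]
    refine ENNReal.tsum_le_tsum fun m => ?_
    refine setLIntegral_le_ofReal_mul_log_sub (threshold_pos h.tendsto m)
      (threshold_mono h.tendsto m.le_succ) (by positivity) fun t ht => ?_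
    have le_psi_sq : (m : ℝ) ≤ ψ t ^ 2 := (Real.sqrt_le_iff.1 (h.sqrt_le_of_threshold_le ht.1)).2
    have psi_le : ψ t ≤ √((m : ℝ) + 1) := by
      exact_mod_cast le_sqrt_of_lt_threshold ((one_le_threshold h.tendsto m).trans ht.1) ht.2
    refine mul_le_mul psi_le (Real.exp_le_exp.2 ?_) (Real.exp_pos _).le (by positivity)
    linarith
  have term_nonneg (m : ℕ) : 0 ≤ √((m : ℝ) + 1) * Real.exp (-m / 2) * logLength ψ m :=
    mul_nonneg (by positivity) (logLength_nonneg h.tendsto m)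
  rw [← ENNReal.ofReal_tsum_of_nonneg term_nonneg hs, hI, top_le_iff] at le_tsum
  exact ENNReal.ofReal_ne_top le_tsum

end IsBarrier

end Integral

/-! ### Regular paths -/

/-- From round `n₀` on, `A² ≥ 1` and Forecaster's moves are small compared with the past of the
path: this is what regularity provides when `ψ` is a barrier. -/
structure TailBound (ψ : ℝ → ℝ) (C : ℝ) (n₀ : ℕ) (ω : Path) : Prop where
  nonneg : 0 ≤ C
  one_le_Asq : ∀ i, n₀ ≤ i → 1 ≤ ω.Asq i
  c_mul_pow_le : ∀ i, n₀ ≤ i → ω.c i * ψ (ω.Asq i) ^ 3 ≤ C * √(ω.Asq i)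
  c_le : ∀ i, n₀ ≤ i → ω.c i ≤ √(ω.Asq i) / 8

section TailBound

variable {ψ : ℝ → ℝ} {C : ℝ} {ω : Path} {i n₀ : ℕ}

lemma Path.A_succ_le_two_mul_sqrt (h : 2 * ω.c i ≤ ω.A (i + 1)) :
    ω.A (i + 1) ≤ 2 * √(ω.Asq i) := by
  refine (abs_le_of_sq_le_sq' ?_ (by positivity)).2
  have c_sq_le : (2 * ω.c i) ^ 2 ≤ ω.A (i + 1) ^ 2 :=
    pow_le_pow_left₀ (mul_nonneg two_pos.le (ω.c_nonneg i)) h 2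
  rw [mul_pow, Real.sq_sqrt (ω.Asq_nonneg i)]
  linarith [ω.A_sq (i + 1), ω.Asq_succ i, ω.sq_x_le i, ω.Asq_nonneg i]

lemma Regular.exists_c_mul_pow_le (hψ : IsBarrier ψ) (h : Regular ψ ω) :
    ∃ C > 0, ∀ᶠ i in atTop, ω.c i * ψ (ω.Asq i) ^ 3 ≤ C * √(ω.Asq i) := by
  obtain ⟨Asq_tendsto, limsup_lt⟩ := h
  obtain ⟨C₁, hC₁, -⟩ := EReal.lt_iff_exists_real_btwn.1 limsup_lt
  set C := max C₁ 1
  have hC : 0 < C := lt_max_of_lt_right one_pos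
  refine ⟨2 * C, by positivity, ?_⟩
  filter_upwards [eventually_lt_of_limsup_lt hC₁, Asq_tendsto.eventually_ge_atTop 1,
    (hψ.tendsto.comp Asq_tendsto).eventually_ge_atTop (max 1 (2 * C))] with i hlt one_le psi_ge
  obtain ⟨one_le_psi, two_C_le_psi⟩ := max_le_iff.1 psi_ge
  simp only [Function.comp_apply] at one_le_psi two_C_le_psi
  have Asq_le : ω.Asq i ≤ ω.Asq (i + 1) := ω.Asq_mono i.le_succ
  have A_pos : 0 < ω.A (i + 1) := Real.sqrt_pos.2 (one_pos.trans_le (one_le.trans Asq_le))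
  have psi_le : ψ (ω.Asq i) ≤ ψ (ω.Asq (i + 1)) :=
    hψ.monotoneOn one_le (one_le.trans Asq_le) Asq_le
  have c_mul_le : ω.c i * ψ (ω.Asq i) ^ 3 ≤ C * ω.A (i + 1) :=
    calc ω.c i * ψ (ω.Asq i) ^ 3 ≤ ω.c i * ψ (ω.Asq (i + 1)) ^ 3 :=
          mul_le_mul_of_nonneg_left (pow_le_pow_left₀ (by linarith) psi_le 3) (ω.c_nonneg i)
      _ ≤ C * ω.A (i + 1) := by
          rw [← div_le_iff₀ A_pos, mul_div_assoc]
          exact (EReal.coe_lt_coe_iff.1 hlt).le.trans (le_max_left _ _)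
  have c_le : 2 * ω.c i ≤ ω.A (i + 1) := by
    have := mul_le_mul_of_nonneg_left
      (two_C_le_psi.trans (le_self_pow₀ one_le_psi three_ne_zero)) (ω.c_nonneg i)
    nlinarith
  nlinarith [Path.A_succ_le_two_mul_sqrt c_le]

lemma Regular.exists_tailBound (hψ : IsBarrier ψ) (h : Regular ψ ω) :
    ∃ C n₀, TailBound ψ C n₀ ω := by
  obtain ⟨C, hC, c_mul_le⟩ := h.exists_c_mul_pow_le hψ
  obtain ⟨n₀, hn₀⟩ := eventually_atTop.1 ((c_mul_le.and (h.1.eventually_ge_atTop 1)).and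
    ((hψ.tendsto.comp h.1).eventually_ge_atTop (max 1 (8 * C))))
  refine ⟨C, n₀, hC.le, fun i hi => (hn₀ i hi).1.2, fun i hi => (hn₀ i hi).1.1, fun i hi => ?_⟩
  obtain ⟨one_le_psi, C_le_psi⟩ := max_le_iff.1 (hn₀ i hi).2
  have := mul_le_mul_of_nonneg_left
    (C_le_psi.trans (le_self_pow₀ one_le_psi three_ne_zero)) (ω.c_nonneg i)
  refine le_of_mul_le_mul_left (?_ : C * ω.c i ≤ C * (√(ω.Asq i) / 8)) hC
  linarith [(hn₀ i hi).1.1, show ω.c i * (8 * C) ≤ ω.c i * ψ (ω.Asq i) ^ 3 from this]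

lemma TailBound.sqrt_div_sqrt_mul_c_le (hω : TailBound ψ C n₀ ω) (hψ : IsBarrier ψ) (hi : n₀ ≤ i)
    {M g r : ℝ} {k : ℕ} (hM : 0 < M) (hk : M / 4 ≤ k) (hthr : threshold ψ k ≤ ω.Asq i)
    (hg : 0 < g) (hr : √(ω.Asq i) ≤ r * √g) : √M / √g * ω.c i ≤ 8 * C * r / M := by
  have psi_ge : √M / 2 ≤ ψ (ω.Asq i) :=
    calc √M / 2 = √(M / 4) := by
          rw [Real.sqrt_div' _ (by norm_num), show (4 : ℝ) = 2 ^ 2 by norm_num,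
            Real.sqrt_sq two_pos.le]
      _ ≤ √(k : ℝ) := Real.sqrt_le_sqrt hk
      _ ≤ ψ (ω.Asq i) := hψ.sqrt_le_of_threshold_le hthr
  have c_mul_le : ω.c i * (√M / 2) ^ 3 ≤ C * (r * √g) :=
    calc ω.c i * (√M / 2) ^ 3 ≤ ω.c i * ψ (ω.Asq i) ^ 3 :=
          mul_le_mul_of_nonneg_left (pow_le_pow_left₀ (by positivity) psi_ge 3) (ω.c_nonneg i)
      _ ≤ C * √(ω.Asq i) := hω.c_mul_pow_le i hi
      _ ≤ C * (r * √g) := mul_le_mul_of_nonneg_left hr hω.nonneg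
  have sqrt_pow : √M ^ 3 = M * √M := by rw [pow_succ, Real.sq_sqrt hM.le]
  rw [div_mul_eq_mul_div, div_le_div_iff₀ (Real.sqrt_pos.2 hg) hM]
  rw [div_pow, sqrt_pow] at c_mul_le
  linarith

end TailBound

/-! ### Series and capped thresholds -/

lemma inv_sqrt_mul_sub_le {a b : ℝ} (ha : 0 < a) (hb : 0 ≤ b) :
    (√a)⁻¹ * (a - b) ≤ 2 * √a - 2 * √b := by
  rw [inv_mul_le_iff₀ (Real.sqrt_pos.2 ha)]
  nlinarith [Real.sq_sqrt ha.le, Real.sq_sqrt hb, sq_nonneg (√a - √b)]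

lemma exists_tendsto_atTop_summable_mul {w : ℕ → ℝ} (hw : ∀ k, 0 < w k) (hs : Summable w) :
    ∃ h : ℕ → ℝ, (∀ k, 0 < h k) ∧ Tendsto h atTop atTop ∧ Summable fun k => h k * w k := by
  -- The reciprocal square roots of the tails work, because their sum against `w` telescopes.
  set tail : ℕ → ℝ := fun k => ∑' j, w (j + k)
  have summable_shift (k : ℕ) : Summable fun j => w (j + k) := (summable_nat_add_iff k).2 hs
  have tail_pos (k : ℕ) : 0 < tail k := (summable_shift k).tsum_pos (fun j => (hw _).le) 0 (hw _)
  have w_eq (k : ℕ) : w k = tail k - tail (k + 1) := by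
    simp only [tail]
    rw [(summable_shift k).tsum_eq_zero_add, zero_add]
    simp only [add_assoc, add_comm 1 k, add_sub_cancel_right]
  have sum_le (n : ℕ) :
      ∑ k ∈ Finset.range n, (√(tail k))⁻¹ * w k ≤ 2 * √(tail 0) - 2 * √(tail n) := by
    rw [← Finset.sum_range_sub' fun k => 2 * √(tail k)]
    exact Finset.sum_le_sum fun k _ => w_eq k ▸
      inv_sqrt_mul_sub_le (tail_pos k) (tail_pos (k + 1)).le
  refine ⟨fun k => (√(tail k))⁻¹, fun k => inv_pos.2 (Real.sqrt_pos.2 (tail_pos k)), ?_, ?_⟩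
  · refine Tendsto.inv_tendsto_nhdsGT_zero (tendsto_nhdsWithin_iff.2
      ⟨?_, Eventually.of_forall fun k => Real.sqrt_pos.2 (tail_pos k)⟩)
    simpa [Function.comp_def] using (Real.continuous_sqrt.tendsto 0).comp (tendsto_sum_nat_add w)
  · refine summable_of_sum_range_le (c := 2 * √(tail 0))
      (fun k => mul_nonneg (inv_nonneg.2 (Real.sqrt_nonneg _)) (hw k).le) fun n => ?_
    linarith [sum_le n, Real.sqrt_nonneg (tail n)]

lemma sqrt_le_two_mul_exp (t : ℝ) : √t ≤ 2 * Real.exp (t / 8) := by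
  refine Real.sqrt_le_iff.2 ⟨by positivity, ?_⟩
  have sq_eq : (2 * Real.exp (t / 8)) ^ 2 = 4 * Real.exp (t / 4) := by
    rw [mul_pow, ← Real.exp_nat_mul]
    norm_num
    ring_nf
  linarith [Real.add_one_le_exp (t / 4)]

lemma summable_exp_neg_nat_div {c : ℝ} (hc : 0 < c) :
    Summable fun m : ℕ => Real.exp (-(m : ℝ) / c) :=
  ((Real.summable_exp_nat_mul_iff (a := -(1 / c))).2 (by simpa using hc)).congr fun m => by
    ring_nf

section Capped

variable {ψ : ℝ → ℝ}

/-- The thresholds of the minimum of `ψ` and `√(4 log log t)`. Capping a barrier makes its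
thresholds grow fast enough to absorb polynomial factors in `m`. -/
noncomputable def cappedThreshold (ψ : ℝ → ℝ) (m : ℕ) : ℝ :=
  max (threshold ψ m) (Real.exp (Real.exp (m / 4)))

/-- The logarithmic length of the `m`-th level of the capped barrier. -/
noncomputable def cappedLogLength (ψ : ℝ → ℝ) (m : ℕ) : ℝ :=
  Real.log (cappedThreshold ψ (m + 1)) - Real.log (cappedThreshold ψ m)

lemma cappedThreshold_pos (ψ : ℝ → ℝ) (m : ℕ) : 0 < cappedThreshold ψ m :=
  lt_max_of_lt_right (Real.exp_pos _)

lemma log_cappedThreshold (hψ : Tendsto ψ atTop atTop) (m : ℕ) :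
    Real.log (cappedThreshold ψ m) = max (Real.log (threshold ψ m)) (Real.exp (m / 4)) := by
  rw [cappedThreshold, Real.strictMonoOn_log.monotoneOn.map_max (threshold_pos hψ m)
    (Real.exp_pos _), Real.log_exp]

lemma cappedThreshold_mono (hψ : Tendsto ψ atTop atTop) : Monotone (cappedThreshold ψ) :=
  fun m n hmn =>
    max_le_max (threshold_mono hψ hmn) (Real.exp_le_exp.2 (Real.exp_le_exp.2 (by gcongr)))

lemma cappedLogLength_nonneg (hψ : Tendsto ψ atTop atTop) (m : ℕ) : 0 ≤ cappedLogLength ψ m :=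
  sub_nonneg.2 (Real.log_le_log (cappedThreshold_pos ψ m) (cappedThreshold_mono hψ m.le_succ))

lemma cappedLogLength_le (hψ : Tendsto ψ atTop atTop) (m : ℕ) :
    cappedLogLength ψ m ≤ logLength ψ m + Real.exp ((m + 1) / 4) := by
  have length_nonneg := logLength_nonneg hψ m
  rw [cappedLogLength, log_cappedThreshold hψ, log_cappedThreshold hψ, sub_le_iff_le_add]
  rw [logLength] at length_nonneg ⊢
  push_cast
  exact max_le
    (by linarith [le_max_left (Real.log (threshold ψ m)) (Real.exp (m / 4)),
      Real.exp_pos (((m : ℝ) + 1) / 4)])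
    (by linarith [le_max_right (Real.log (threshold ψ m)) (Real.exp (m / 4)),
      Real.exp_pos ((m : ℝ) / 4)])

lemma eventually_mul_le_cappedThreshold (ψ : ℝ → ℝ) (K : ℝ) :
    ∀ᶠ m : ℕ in atTop, K * m ≤ cappedThreshold ψ m := by
  filter_upwards [tendsto_natCast_atTop_atTop.eventually_ge_atTop (32 * K)] with m hm
  have hm0 : (0 : ℝ) ≤ m := m.cast_nonneg
  have sq_le_exp_exp : (m : ℝ) ^ 2 / 32 ≤ Real.exp (Real.exp (m / 4)) := by
    nlinarith [Real.add_one_le_exp ((m : ℝ) / 4),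
      Real.quadratic_le_exp_of_nonneg (Real.exp_pos ((m : ℝ) / 4)).le]
  calc K * m ≤ m ^ 2 / 32 := by nlinarith [mul_le_mul_of_nonneg_right hm hm0]
    _ ≤ cappedThreshold ψ m := sq_le_exp_exp.trans (le_max_right _ _)

lemma tendsto_cappedThreshold (ψ : ℝ → ℝ) : Tendsto (cappedThreshold ψ) atTop atTop :=
  tendsto_atTop_mono' _ ((eventually_mul_le_cappedThreshold ψ 1).mono fun m hm => by
    rwa [one_mul] at hm) tendsto_natCast_atTop_atTop

lemma summable_cappedLogLength (hψ : Tendsto ψ atTop atTop)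
    (hs : Summable fun m : ℕ => logLength ψ m * (√m * Real.exp (-m / 2))) :
    Summable fun m : ℕ => cappedLogLength ψ m * (√m * Real.exp (-m / 2)) := by
  refine Summable.of_nonneg_of_le
    (fun m => mul_nonneg (cappedLogLength_nonneg hψ m) (by positivity)) (fun m => ?_)
    (hs.add ((summable_exp_neg_nat_div (c := 8) (by norm_num)).mul_left (2 * Real.exp (1 / 4))))
  refine (mul_le_mul_of_nonneg_right (cappedLogLength_le hψ m) (by positivity)).trans ?_
  rw [add_mul]
  refine add_le_add le_rfl ?_
  calc Real.exp ((m + 1) / 4) * (√m * Real.exp (-m / 2))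
      ≤ Real.exp ((m + 1) / 4) * (2 * Real.exp (m / 8) * Real.exp (-m / 2)) := by
        gcongr; exact sqrt_le_two_mul_exp m
    _ = 2 * (Real.exp ((m + 1) / 4) * Real.exp (m / 8) * Real.exp (-m / 2)) := by ring
    _ = 2 * (Real.exp (1 / 4) * Real.exp (-m / 8)) := by
        rw [← Real.exp_add, ← Real.exp_add, ← Real.exp_add]; ring_nf
    _ = 2 * Real.exp (1 / 4) * Real.exp (-m / 8) := by ring

lemma summable_logLength_mul_exp (hψ : Tendsto ψ atTop atTop)
    (hs : Summable fun m : ℕ => logLength ψ m * (√m * Real.exp (-m / 2))) :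
    Summable fun m : ℕ => logLength ψ m * Real.exp (-m / 2) := by
  refine hs.of_norm_bounded_eventually_nat ?_
  filter_upwards [eventually_ge_atTop 1] with m hm
  have hℓ := logLength_nonneg hψ m
  rw [Real.norm_of_nonneg (by positivity)]
  refine mul_le_mul_of_nonneg_left (le_mul_of_one_le_left (Real.exp_pos _).le ?_) hℓ
  exact Real.one_le_sqrt.2 (Nat.one_le_cast.2 hm)

lemma exists_log_threshold_le (hψ : Tendsto ψ atTop atTop)
    (hs : Summable fun m : ℕ => logLength ψ m * (√m * Real.exp (-m / 2))) :
    ∃ c ≥ 0, ∀ m : ℕ, Real.log (threshold ψ m) ≤ c * Real.exp (m / 2) := by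
  have term_nonneg (m : ℕ) : 0 ≤ logLength ψ m * Real.exp (-m / 2) :=
    mul_nonneg (logLength_nonneg hψ m) (Real.exp_pos _).le
  refine ⟨∑' j : ℕ, logLength ψ j * Real.exp (-j / 2), tsum_nonneg term_nonneg, fun m => ?_⟩
  calc Real.log (threshold ψ m)
      = ∑ j ∈ Finset.range m, logLength ψ j * Real.exp (-j / 2) * Real.exp (j / 2) := by
        rw [log_threshold_eq_sum]
        refine Finset.sum_congr rfl fun j _ => ?_
        rw [mul_assoc, ← Real.exp_add, neg_div, neg_add_cancel, Real.exp_zero, mul_one]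
    _ ≤ ∑ j ∈ Finset.range m, logLength ψ j * Real.exp (-j / 2) * Real.exp (m / 2) := by
        refine Finset.sum_le_sum fun j hj => mul_le_mul_of_nonneg_left ?_ (term_nonneg j)
        have := Finset.mem_range.1 hj
        gcongr
    _ ≤ (∑' j : ℕ, logLength ψ j * Real.exp (-j / 2)) * Real.exp (m / 2) := by
        rw [← Finset.sum_mul]
        exact mul_le_mul_of_nonneg_right
          ((summable_logLength_mul_exp hψ hs).sum_le_tsum _ fun j _ => term_nonneg j)
          (Real.exp_pos _).le

lemma eventually_threshold_div_mul_le_cappedThreshold (hψ : Tendsto ψ atTop atTop)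
    (hs : Summable fun m : ℕ => logLength ψ m * (√m * Real.exp (-m / 2))) :
    ∀ᶠ m : ℕ in atTop, threshold ψ (m / 3) * m ≤ cappedThreshold ψ m := by
  obtain ⟨c, hc, log_le⟩ := exists_log_threshold_le hψ hs
  have exp_tendsto : Tendsto (fun m : ℕ => Real.exp ((m : ℝ) / 12)) atTop atTop :=
    Real.tendsto_exp_atTop.comp (tendsto_natCast_atTop_atTop.atTop_div_const (by norm_num))
  filter_upwards [exp_tendsto.eventually_ge_atTop (c + 6), eventually_ge_atTop 1] with m hm hm1
  have hm0 : (0 : ℝ) < m := Nat.cast_pos.2 hm1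
  have hthr := threshold_pos hψ (m / 3)
  have log_threshold_le : Real.log (threshold ψ (m / 3)) ≤ c * Real.exp (m / 6) := by
    refine (log_le _).trans (mul_le_mul_of_nonneg_left (Real.exp_le_exp.2 ?_) hc)
    linarith [Nat.cast_div_le (α := ℝ) (m := m) (n := 3)]
  have log_nat_le : Real.log m ≤ 6 * Real.exp (m / 6) := by
    linarith [Real.log_le_sub_one_of_pos hm0, Real.add_one_le_exp ((m : ℝ) / 6)]
  refine le_trans ?_ (le_max_right _ _)
  rw [← Real.log_le_iff_le_exp (mul_pos hthr hm0), Real.log_mul hthr.ne' hm0.ne']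
  calc Real.log (threshold ψ (m / 3)) + Real.log m ≤ (c + 6) * Real.exp (m / 6) := by linarith
    _ ≤ Real.exp (m / 12) * Real.exp (m / 6) :=
        mul_le_mul_of_nonneg_right hm (Real.exp_pos _).le
    _ = Real.exp (m / 4) := by rw [← Real.exp_add]; ring_nf

end Capped

/-! ### Forcing `S < A ψ(A²)` -/

lemma Path.sum_ite_sq_le {ω : Path} {B : ℝ} (hB : 0 ≤ B)
    (hx : ∀ i, ω.Asq i ≤ B → ω.x i ^ 2 ≤ B) (n : ℕ) :
    ∑ i ∈ Finset.range n, (if ω.Asq i ≤ B then ω.x i ^ 2 else 0) ≤ min (ω.Asq n) (2 * B) := by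
  induction n with
  | zero => simp [Path.Asq, hB]
  | succ n ih =>
    obtain ⟨le_Asq, le_two_B⟩ := le_min_iff.1 ih
    rw [Finset.sum_range_succ, ω.Asq_succ]
    have x_sq_nonneg := sq_nonneg (ω.x n)
    split_ifs with hn
    · exact le_min (by linarith) (by linarith [hx n hn])
    · exact le_min (by linarith) (by linarith)

lemma Path.sum_error_le {ω : Path} {γ B η : ℝ} {n : ℕ} (hB : 0 ≤ B) (hη : 0 ≤ η)
    (hx : ∀ i, ω.Asq i ≤ B → ω.x i ^ 2 ≤ B)
    (hsmall : ∀ i < n, ω.Asq i ≤ B → |γ| * ω.c i ≤ 1 / 2)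
    (hlarge : ∀ i < n, B < ω.Asq i → |γ| * ω.c i ≤ η) :
    ∑ i ∈ Finset.range n, 2 * (|γ| * ω.c i) * (γ ^ 2 * ω.x i ^ 2) ≤
      γ ^ 2 * (2 * B) + 2 * η * (γ ^ 2 * ω.Asq n) := by
  have term_le : ∀ i ∈ Finset.range n, 2 * (|γ| * ω.c i) * (γ ^ 2 * ω.x i ^ 2) ≤
      γ ^ 2 * (if ω.Asq i ≤ B then ω.x i ^ 2 else 0) + 2 * η * (γ ^ 2 * ω.x i ^ 2) := by
    intro i hi
    have hin := Finset.mem_range.1 hi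
    have sq_nonneg : 0 ≤ γ ^ 2 * ω.x i ^ 2 := by positivity
    split_ifs with h
    · linarith [mul_le_mul_of_nonneg_right (hsmall i hin h) sq_nonneg, mul_nonneg hη sq_nonneg]
    · linarith [mul_le_mul_of_nonneg_right (hlarge i hin (not_le.1 h)) sq_nonneg]
  refine (Finset.sum_le_sum term_le).trans ?_
  rw [Finset.sum_add_distrib, ← Finset.mul_sum, ← Finset.mul_sum, ← Finset.mul_sum]
  have sum_le := (ω.sum_ite_sq_le hB hx n).trans (min_le_right _ _)
  exact add_le_add (mul_le_mul_of_nonneg_left sum_le (sq_nonneg γ)) le_rfl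

section Upper

variable {ψ : ℝ → ℝ} {C : ℝ} {n₀ m : ℕ} {ω : Path}

/-- The number of grid points in the `m`-th level of the capped barrier. -/
noncomputable def gridSize (ψ : ℝ → ℝ) (m : ℕ) : ℕ := ⌈cappedLogLength ψ m * √m⌉₊ + 1

/-- The `j`-th grid point in the `m`-th level of the capped barrier; on the logarithmic scale, the
grid has the spacing `1 / √m`. -/
noncomputable def gridPoint (ψ : ℝ → ℝ) (m j : ℕ) : ℝ := cappedThreshold ψ m * Real.exp (j / √m)

/-- The bets against `S ≥ A ψ(A²)` in the `m`-th level: for each grid point `g`, they stake a share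
of the capital as if the inequality were to happen for `A²` close to `g`. -/
noncomputable def upperBet (ψ : ℝ → ℝ) (m : ℕ) : Path → ℕ → ℝ :=
  averageBet (Finset.range (gridSize ψ m)) fun j =>
    expBet (√m / √(gridPoint ψ m j)) 0 (cappedThreshold ψ (m + 1))

lemma exp_le_sq_one_add {y : ℝ} (h0 : 0 ≤ y) (h1 : y ≤ 1) : Real.exp y ≤ (1 + y) ^ 2 := by
  have h := (abs_le.1 (Real.abs_exp_sub_one_sub_id_le (abs_le.2 ⟨by linarith, h1⟩))).2
  nlinarith

lemma cappedThreshold_le_gridPoint (ψ : ℝ → ℝ) (m j : ℕ) :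
    cappedThreshold ψ m ≤ gridPoint ψ m j :=
  le_mul_of_one_le_right (cappedThreshold_pos ψ m).le (Real.one_le_exp (by positivity))

lemma exists_div_gridPoint_eq_exp {D l : ℝ} (hm : 1 ≤ m) (hD : D = √m)
    (h1 : cappedThreshold ψ m ≤ l) (h2 : l < cappedThreshold ψ (m + 1)) :
    ∃ j ∈ Finset.range (gridSize ψ m), ∃ y, 0 ≤ y ∧ y ≤ 1 / D ∧
      l / gridPoint ψ m j = Real.exp y := by
  have thr_pos := cappedThreshold_pos ψ m
  have hl : 0 < l := thr_pos.trans_le h1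
  have hD0 : 0 < D := hD ▸ Real.sqrt_pos.2 (Nat.cast_pos.2 hm)
  set z := (Real.log l - Real.log (cappedThreshold ψ m)) * D with hz
  have z_nonneg : 0 ≤ z := mul_nonneg (sub_nonneg.2 (Real.log_le_log thr_pos h1)) hD0.le
  have z_le : z ≤ cappedLogLength ψ m * √m := by
    rw [hz, cappedLogLength, ← hD]
    gcongr
  have l_eq : l = cappedThreshold ψ m * Real.exp (z / D) := by
    rw [hz, mul_div_cancel_right₀ _ hD0.ne', Real.exp_sub, Real.exp_log hl, Real.exp_log thr_pos,
      mul_div_cancel₀ _ thr_pos.ne']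
  refine ⟨⌊z⌋₊, Finset.mem_range.2 ?_, (z - ⌊z⌋₊) / D,
    div_nonneg (sub_nonneg.2 (Nat.floor_le z_nonneg)) hD0.le,
    div_le_div_of_nonneg_right (by linarith [Nat.lt_floor_add_one z]) hD0.le, ?_⟩
  · exact Nat.lt_succ_of_le ((Nat.floor_le_floor z_le).trans (Nat.floor_le_ceil _))
  · rw [gridPoint, ← hD, sub_div, Real.exp_sub, l_eq, mul_div_mul_left _ _ thr_pos.ne']

lemma exists_gridPoint {l : ℝ} (hm : 1 ≤ m)
    (h1 : cappedThreshold ψ m ≤ l) (h2 : l < cappedThreshold ψ (m + 1)) :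
    ∃ j ∈ Finset.range (gridSize ψ m), 1 ≤ √l / √(gridPoint ψ m j) ∧
      √l / √(gridPoint ψ m j) ≤ 1 + 1 / √m := by
  have hl : 0 ≤ l := (cappedThreshold_pos ψ m).le.trans h1
  have one_le_sqrt : 1 ≤ √(m : ℝ) := Real.one_le_sqrt.2 (Nat.one_le_cast.2 hm)
  have inv_le_one : 1 / √(m : ℝ) ≤ 1 := (div_le_one (by linarith)).2 one_le_sqrt
  obtain ⟨j, hj, y, y_nonneg, y_le, ratio_eq⟩ := exists_div_gridPoint_eq_exp hm rfl h1 h2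
  refine ⟨j, hj, ?_⟩
  rw [← Real.sqrt_div hl, ratio_eq]
  exact ⟨Real.one_le_sqrt.2 (Real.one_le_exp y_nonneg), Real.sqrt_le_iff.2 ⟨by positivity,
    (Real.exp_le_exp.2 y_le).trans (exp_le_sq_one_add (by positivity) inv_le_one)⟩⟩

/-- The level `m` is so late that the first `n₀` rounds are negligible in it. -/
structure LateLevel (ψ : ℝ → ℝ) (C : ℝ) (n₀ : ℕ) (ω : Path) (m : ℕ) : Prop where
  sixteen_le : 16 ≤ m
  mul_C_le : 64 * C ≤ m
  threshold_mul_le : threshold ψ (m / 3) * m ≤ cappedThreshold ψ m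
  sum_c_sq_mul_le : 4 * (∑ i ∈ Finset.range n₀, ω.c i) ^ 2 * m ≤ cappedThreshold ψ m
  Asq_mul_le : ω.Asq n₀ * m ≤ cappedThreshold ψ m

lemma eventually_lateLevel (hψ : Tendsto ψ atTop atTop)
    (hs : Summable fun m : ℕ => logLength ψ m * (√m * Real.exp (-m / 2)))
    (C : ℝ) (n₀ : ℕ) (ω : Path) : ∀ᶠ m in atTop, LateLevel ψ C n₀ ω m := by
  filter_upwards [eventually_ge_atTop 16,
    tendsto_natCast_atTop_atTop.eventually_ge_atTop (64 * C),
    eventually_threshold_div_mul_le_cappedThreshold hψ hs,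
    eventually_mul_le_cappedThreshold ψ _, eventually_mul_le_cappedThreshold ψ _]
    with m h1 h2 h3 h4 h5 using ⟨h1, h2, h3, h4, h5⟩

namespace LateLevel

variable {i n : ℕ} {g l : ℝ}

lemma cast_pos (hm : LateLevel ψ C n₀ ω m) : (0 : ℝ) < m :=
  Nat.cast_pos.2 (by have := hm.sixteen_le; omega)

lemma four_mul_c_sq_mul_le (hm : LateLevel ψ C n₀ ω m) (hi : i < n₀) :
    4 * ω.c i ^ 2 * m ≤ cappedThreshold ψ m := by
  have c_le : ω.c i ≤ ∑ i ∈ Finset.range n₀, ω.c i :=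
    Finset.single_le_sum (fun k _ => ω.c_nonneg k) (Finset.mem_range.2 hi)
  refine le_trans ?_ hm.sum_c_sq_mul_le
  have := pow_le_pow_left₀ (ω.c_nonneg i) c_le 2
  gcongr

lemma sq_x_le (hm : LateLevel ψ C n₀ ω m) (hω : TailBound ψ C n₀ ω)
    (hl : cappedThreshold ψ m ≤ l) (hi : ω.Asq i ≤ l / m) : ω.x i ^ 2 ≤ l / m := by
  refine (ω.sq_x_le i).trans ?_
  rcases lt_or_ge i n₀ with early | late
  · rw [le_div_iff₀ hm.cast_pos]
    linarith [hm.four_mul_c_sq_mul_le early, mul_nonneg (sq_nonneg (ω.c i)) hm.cast_pos.le]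
  · have c_sq_le := pow_le_pow_left₀ (ω.c_nonneg i) (hω.c_le i late) 2
    rw [div_pow, Real.sq_sqrt (ω.Asq_nonneg i)] at c_sq_le
    linarith [ω.Asq_nonneg i]

lemma sqrt_div_sqrt_mul_c_le_half (hm : LateLevel ψ C n₀ ω m) (hω : TailBound ψ C n₀ ω)
    (hg : cappedThreshold ψ m ≤ g) (hlg : √l ≤ 2 * √g) (hi : ω.Asq i ≤ l / m) :
    √m / √g * ω.c i ≤ 1 / 2 := by
  have sqrt_g_pos : 0 < √g := Real.sqrt_pos.2 ((cappedThreshold_pos ψ m).trans_le hg)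
  have sq_sqrt_m : √(m : ℝ) ^ 2 = m := Real.sq_sqrt m.cast_nonneg
  rw [div_mul_eq_mul_div, div_le_iff₀ sqrt_g_pos]
  rcases lt_or_ge i n₀ with early | late
  · have : √m * ω.c i * 2 ≤ √g := by
      refine Real.le_sqrt_of_sq_le (le_trans ?_ hg)
      rw [mul_pow, mul_pow, sq_sqrt_m]
      linarith [hm.four_mul_c_sq_mul_le early]
    linarith
  · have : √(ω.Asq i) * √m ≤ √l := by
      rw [← Real.sqrt_mul (ω.Asq_nonneg i)]
      exact Real.sqrt_le_sqrt ((le_div_iff₀ hm.cast_pos).1 hi)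
    linarith [mul_le_mul_of_nonneg_left (hω.c_le i late) (Real.sqrt_nonneg m)]

lemma sqrt_div_sqrt_mul_c_le (hm : LateLevel ψ C n₀ ω m) (hψ : IsBarrier ψ)
    (hω : TailBound ψ C n₀ ω) (hg : cappedThreshold ψ m ≤ g) (hlg : √(ω.Asq n) ≤ 2 * √g)
    (hl : cappedThreshold ψ m ≤ ω.Asq n) (hin : i ≤ n) (hi : ω.Asq n / m < ω.Asq i) :
    √m / √g * ω.c i ≤ 16 * C / m := by
  have le_Asq {a : ℝ} (ha : a * m ≤ cappedThreshold ψ m) : a ≤ ω.Asq i :=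
    ((le_div_iff₀ hm.cast_pos).2 (ha.trans hl)).trans hi.le
  have hn₀ : n₀ ≤ i := by
    by_contra! early
    refine hi.not_ge ((ω.Asq_mono early.le).trans ?_)
    exact (le_div_iff₀ hm.cast_pos).2 (hm.Asq_mul_le.trans hl)
  have quarter_le : (m : ℝ) / 4 ≤ ((m / 3 : ℕ) : ℝ) := by
    have nat_le : m ≤ 4 * (m / 3) := by have := hm.sixteen_le; omega
    have : (m : ℝ) ≤ 4 * ((m / 3 : ℕ) : ℝ) := mod_cast nat_le
    linarith
  refine (hω.sqrt_div_sqrt_mul_c_le hψ hn₀ hm.cast_pos quarter_le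
    (le_Asq hm.threshold_mul_le) ((cappedThreshold_pos ψ m).trans_le hg)
    ((Real.sqrt_le_sqrt (ω.Asq_mono hin)).trans hlg)).trans_eq ?_
  ring

lemma exp_le_expCapital (hm : LateLevel ψ C n₀ ω m) (hψ : IsBarrier ψ) (hω : TailBound ψ C n₀ ω)
    (hg : cappedThreshold ψ m ≤ g) (hlg : √(ω.Asq n) ≤ 2 * √g)
    (h1 : cappedThreshold ψ m ≤ ω.Asq n) (h2 : ω.Asq n < cappedThreshold ψ (m + 1)) :
    Real.exp (√m / √g * ω.S n - (√m / √g) ^ 2 * ω.Asq n / 2 - (8 + 128 * C)) ≤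
      expCapital (√m / √g) 0 (cappedThreshold ψ (m + 1)) ω n := by
  set γ := √m / √g with hγ
  have hm0 := hm.cast_pos
  have hg0 : 0 < g := (cappedThreshold_pos ψ m).trans_le hg
  have hC := hω.nonneg
  have γ_nonneg : 0 ≤ γ := by positivity
  have γ_sq_mul_le : γ ^ 2 * ω.Asq n ≤ 4 * m := by
    have Asq_le : ω.Asq n ≤ 4 * g := by
      have := pow_le_pow_left₀ (Real.sqrt_nonneg _) hlg 2
      rw [mul_pow, Real.sq_sqrt (ω.Asq_nonneg n), Real.sq_sqrt hg0.le] at this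
      linarith
    rw [hγ, div_pow, Real.sq_sqrt hm0.le, Real.sq_sqrt hg0.le, div_mul_eq_mul_div,
      div_le_iff₀ hg0]
    nlinarith
  have small (i : ℕ) (hi : ω.Asq i ≤ ω.Asq n / m) : |γ| * ω.c i ≤ 1 / 2 :=
    (abs_of_nonneg γ_nonneg).symm ▸ hm.sqrt_div_sqrt_mul_c_le_half hω hg hlg hi
  have large (i : ℕ) (hin : i < n) (hi : ω.Asq n / m < ω.Asq i) : |γ| * ω.c i ≤ 16 * C / m :=
    (abs_of_nonneg γ_nonneg).symm ▸ hm.sqrt_div_sqrt_mul_c_le hψ hω hg hlg h1 hin.le hi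
  have half_le : 16 * C / m ≤ 1 / 2 := by
    rw [div_le_iff₀ hm0]; linarith [hm.mul_C_le]
  have error_le := Path.sum_error_le (div_nonneg (ω.Asq_nonneg n) hm0.le)
    (div_nonneg (by positivity) hm0.le) (fun i => hm.sq_x_le hω h1) (fun i _ => small i) large
  have error_eq : γ ^ 2 * (2 * (ω.Asq n / m)) + 2 * (16 * C / m) * (γ ^ 2 * ω.Asq n) =
      (2 + 32 * C) * (γ ^ 2 * ω.Asq n / m) := by ring
  have ratio_le : γ ^ 2 * ω.Asq n / m ≤ 4 := (div_le_iff₀ hm0).2 γ_sq_mul_le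
  refine le_trans (Real.exp_le_exp.2 ?_)
    (SPUFG.exp_le_expCapital (fun i hi => (ω.Asq_mono hi.le).trans_lt h2) fun i hi =>
      (le_or_gt (ω.Asq i) (ω.Asq n / m)).elim (small i) fun h => (large i hi h).trans half_le)
  nlinarith [mul_le_mul_of_nonneg_left ratio_le (show 0 ≤ 2 + 32 * C by positivity)]

lemma exists_exp_le_expCapital (hm : LateLevel ψ C n₀ ω m) (hψ : IsBarrier ψ)
    (hω : TailBound ψ C n₀ ω) (h1 : cappedThreshold ψ m ≤ ω.Asq n)
    (h2 : ω.Asq n < cappedThreshold ψ (m + 1)) (hS : ω.A n * ψ (ω.Asq n) ≤ ω.S n) :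
    ∃ j ∈ Finset.range (gridSize ψ m), Real.exp ((m : ℝ) / 2 - (9 + 128 * C)) ≤
      expCapital (√m / √(gridPoint ψ m j)) 0 (cappedThreshold ψ (m + 1)) ω n := by
  have one_le_m : 1 ≤ m := by have := hm.sixteen_le; omega
  obtain ⟨j, hj, one_le_ratio, ratio_le⟩ := exists_gridPoint one_le_m h1 h2
  refine ⟨j, hj, ?_⟩
  have hg := cappedThreshold_le_gridPoint ψ m j
  have sqrt_g_pos : 0 < √(gridPoint ψ m j) :=
    Real.sqrt_pos.2 ((cappedThreshold_pos ψ m).trans_le hg)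
  set D := √(m : ℝ)
  set ρ := √(ω.Asq n) / √(gridPoint ψ m j) with hρ
  have D_sq : D ^ 2 = m := Real.sq_sqrt m.cast_nonneg
  have one_le_D : 1 ≤ D := Real.one_le_sqrt.2 (Nat.one_le_cast.2 one_le_m)
  have hD : 0 < D := by linarith
  have sqrt_le : √(ω.Asq n) ≤ 2 * √(gridPoint ψ m j) := by
    rw [← div_le_iff₀ sqrt_g_pos]
    linarith [(div_le_one hD).2 one_le_D]
  refine le_trans (Real.exp_le_exp.2 ?_) (hm.exp_le_expCapital hψ hω hg sqrt_le h1 h2)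
  have gain : D ^ 2 * ρ ≤ D / √(gridPoint ψ m j) * ω.S n :=
    calc D ^ 2 * ρ = D / √(gridPoint ψ m j) * (√(ω.Asq n) * D) := by rw [hρ]; ring
      _ ≤ D / √(gridPoint ψ m j) * ω.S n := by
        refine mul_le_mul_of_nonneg_left (le_trans ?_ hS) (by positivity)
        exact mul_le_mul_of_nonneg_left
          (hψ.sqrt_le_of_threshold_le ((le_max_left _ _).trans h1)) (Real.sqrt_nonneg _)
  have variance : (D / √(gridPoint ψ m j)) ^ 2 * ω.Asq n = D ^ 2 * ρ ^ 2 := by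
    rw [hρ, div_pow, div_pow, Real.sq_sqrt (ω.Asq_nonneg n)]; ring
  have deviation_le : D ^ 2 * (ρ - 1) ^ 2 ≤ 1 := by
    rw [← mul_pow]
    refine pow_le_one₀ (mul_nonneg hD.le (by linarith)) ?_
    rw [mul_comm, ← le_div_iff₀ hD]
    linarith
  rw [variance]
  linarith [show D ^ 2 * (ρ - 1) ^ 2 = D ^ 2 * ρ ^ 2 - 2 * (D ^ 2 * ρ) + D ^ 2 by ring]

lemma reaches_upperBet (hm : LateLevel ψ C n₀ ω m) (hψ : IsBarrier ψ)
    (hω : TailBound ψ C n₀ ω) (h1 : cappedThreshold ψ m ≤ ω.Asq n)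
    (h2 : ω.Asq n < cappedThreshold ψ (m + 1)) (hS : ω.A n * ψ (ω.Asq n) ≤ ω.S n) :
    Reaches ((gridSize ψ m : ℝ)⁻¹ * Real.exp ((m : ℝ) / 2 - (9 + 128 * C))) (upperBet ψ m) ω := by
  obtain ⟨j, hj, exp_le⟩ := hm.exists_exp_le_expCapital hψ hω h1 h2 hS
  refine ⟨n, ?_, fun i _ => prudent_averageBet ⟨j, hj⟩ (fun _ => prudent_expBet _ _ _) ω i⟩
  refine le_trans ?_ (inv_card_mul_wealth_le_averageBet (fun _ => prudent_expBet _ _ _) hj ω n)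
  rw [Finset.card_range, wealth_expBet]
  exact mul_le_mul_of_nonneg_left exp_le (by positivity)

end LateLevel

lemma predictable_upperBet (ψ : ℝ → ℝ) (m : ℕ) : Predictable (upperBet ψ m) :=
  Predictable.averageBet fun j => predictable_expBet (√m / √(gridPoint ψ m j)) 0 _

lemma gridSize_pos (ψ : ℝ → ℝ) (m : ℕ) : 0 < (gridSize ψ m : ℝ) :=
  Nat.cast_pos.2 (Nat.succ_pos _)

lemma summable_gridSize_mul_exp (hψ : Tendsto ψ atTop atTop)
    (hs : Summable fun m : ℕ => logLength ψ m * (√m * Real.exp (-m / 2))) :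
    Summable fun m : ℕ => (gridSize ψ m : ℝ) * Real.exp (-m / 2) := by
  refine Summable.of_nonneg_of_le (fun m => by positivity) (fun m => ?_)
    ((summable_cappedLogLength hψ hs).add
      ((summable_exp_neg_nat_div (c := 2) two_pos).mul_left 2))
  have ceil_lt := Nat.ceil_lt_add_one
    (mul_nonneg (cappedLogLength_nonneg hψ m) (Real.sqrt_nonneg m))
  have gridSize_le : (gridSize ψ m : ℝ) ≤ cappedLogLength ψ m * √m + 2 := by
    rw [gridSize]
    push_cast
    linarith
  nlinarith [Real.exp_pos (-(m : ℝ) / 2)]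

lemma exists_cappedThreshold_le_lt {l : ℝ} {M : ℕ} (hl : cappedThreshold ψ M ≤ l) :
    ∃ m ≥ M, cappedThreshold ψ m ≤ l ∧ l < cappedThreshold ψ (m + 1) := by
  by_contra! h
  have le_l (m : ℕ) (hm : M ≤ m) : cappedThreshold ψ m ≤ l :=
    Nat.le_induction hl (fun m hm ih => h m hm ih) m hm
  obtain ⟨m, hlt, hm⟩ :=
    (((tendsto_cappedThreshold ψ).eventually_gt_atTop l).and (eventually_ge_atTop M)).exists
  exact hlt.not_ge (le_l m hm)

theorem canForce_upper {α : ℝ} (hα : 0 < α) (hψ : IsBarrier ψ) (hI : integralI ψ < ⊤) :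
    CanForce α fun ω => Regular ψ ω → ∀ᶠ n in atTop, ω.S n < ω.A n * ψ (ω.Asq n) := by
  have hs := hψ.summable_of_integralI_lt_top hI
  set w : ℕ → ℝ := fun m => (gridSize ψ m : ℝ) * Real.exp (-m / 2) with hw
  have w_pos (m : ℕ) : 0 < w m := mul_pos (gridSize_pos ψ m) (Real.exp_pos _)
  obtain ⟨h, h_pos, h_tendsto, h_summable⟩ :=
    exists_tendsto_atTop_summable_mul w_pos (summable_gridSize_mul_exp hψ.tendsto hs)
  have sqrt_h_tendsto := Real.tendsto_sqrt_atTop.comp h_tendsto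
  refine canForce_of_frequently_reaches hα (predictable_upperBet ψ)
    (T := fun m => (w m * √(h m))⁻¹) (fun m => mul_pos (h_pos m) (w_pos m)) h_summable
    (sqrt_h_tendsto.congr fun m => ?_) fun ω hω => ?_
  · have sqrt_pos := Real.sqrt_pos.2 (h_pos m)
    have := w_pos m
    rw [Function.comp_apply, eq_mul_inv_iff_mul_eq₀ (by positivity), mul_left_comm,
      Real.mul_self_sqrt (h_pos m).le, mul_comm]
  · push Not at hω
    obtain ⟨regular, le_S⟩ := hω
    obtain ⟨C, n₀, tailBound⟩ := regular.exists_tailBound hψ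
    refine frequently_atTop.2 fun M => ?_
    obtain ⟨M', hM'⟩ := eventually_atTop.1
      (((eventually_lateLevel hψ.tendsto hs C n₀ ω).and
        (sqrt_h_tendsto.eventually_ge_atTop (Real.exp (9 + 128 * C)))).and (eventually_ge_atTop M))
    obtain ⟨n, le_Sn, le_Asq⟩ :=
      (le_S.and_eventually (regular.1.eventually_ge_atTop (cappedThreshold ψ M'))).exists
    obtain ⟨m, hm, h1, h2⟩ := exists_cappedThreshold_le_lt le_Asq
    obtain ⟨⟨late, exp_le⟩, hMm⟩ := hM' m hm
    refine ⟨m, hMm, (late.reaches_upperBet hψ tailBound h1 h2 le_Sn).mono ?_⟩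
    calc (w m * √(h m))⁻¹ = (gridSize ψ m : ℝ)⁻¹ * (Real.exp (m / 2) / √(h m)) := by
          rw [hw, mul_inv, mul_inv, ← Real.exp_neg, neg_div, neg_neg, mul_assoc, ← div_eq_mul_inv]
      _ ≤ (gridSize ψ m : ℝ)⁻¹ * Real.exp (m / 2 - (9 + 128 * C)) := by
          rw [Real.exp_sub]
          gcongr
          exact exp_le

end Upper

/-! ### Cycles -/

section Cycles

variable {ψ : ℝ → ℝ} {m q : ℕ}

/-- The number of cycles, disjoint intervals of logarithmic length `2 * √(m + 1)`, into which the
`m`-th level is divided. It is capped so that it stays negligible against the gain `exp (m + 1)`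
of `startBet`. -/
noncomputable def cycleCount (ψ : ℝ → ℝ) (m : ℕ) : ℕ :=
  min ⌊logLength ψ m / (2 * √(m + 1))⌋₊ ⌊Real.exp (m / 2)⌋₊

/-- The value of `A²` at which the `q`-th cycle of the `m`-th level starts. -/
noncomputable def cycleStart (ψ : ℝ → ℝ) (m q : ℕ) : ℝ :=
  threshold ψ m * Real.exp (2 * √(m + 1) * q)

lemma threshold_le_cycleStart (hψ : Tendsto ψ atTop atTop) (m q : ℕ) :
    threshold ψ m ≤ cycleStart ψ m q :=
  le_mul_of_one_le_right (threshold_pos hψ m).le (Real.one_le_exp (by positivity))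

lemma cycleStart_pos (hψ : Tendsto ψ atTop atTop) (m q : ℕ) : 0 < cycleStart ψ m q :=
  mul_pos (threshold_pos hψ m) (Real.exp_pos _)

lemma cycleStart_mono (hψ : Tendsto ψ atTop atTop) (m : ℕ) : Monotone (cycleStart ψ m) :=
  fun _ _ h => mul_le_mul_of_nonneg_left (Real.exp_le_exp.2 (by gcongr)) (threshold_pos hψ m).le

lemma cycleStart_succ (ψ : ℝ → ℝ) (m q : ℕ) :
    cycleStart ψ m (q + 1) = cycleStart ψ m q * Real.exp (2 * √(m + 1)) := by
  rw [cycleStart, cycleStart, mul_assoc (threshold ψ m), ← Real.exp_add]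
  push_cast
  ring_nf

lemma cycleStart_succ_le_threshold (hψ : Tendsto ψ atTop atTop) (hq : q < cycleCount ψ m) :
    cycleStart ψ m (q + 1) ≤ threshold ψ (m + 1) := by
  have len_pos : 0 < 2 * √((m : ℝ) + 1) := by positivity
  have le_logLength : ((q + 1 : ℕ) : ℝ) * (2 * √(m + 1)) ≤ logLength ψ m := by
    rw [← le_div_iff₀ len_pos, ← Nat.le_floor_iff (div_nonneg (logLength_nonneg hψ m) len_pos.le)]
    exact Nat.succ_le_of_lt (hq.trans_le (min_le_left _ _))
  have exp_le := Real.exp_le_exp.2 le_logLength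
  rw [logLength, Real.exp_sub, Real.exp_log (threshold_pos hψ _), Real.exp_log (threshold_pos hψ _),
    le_div_iff₀ (threshold_pos hψ m)] at exp_le
  rwa [cycleStart, mul_comm (2 * √((m : ℝ) + 1)), mul_comm]

lemma cycleCount_le_exp (ψ : ℝ → ℝ) (m : ℕ) : (cycleCount ψ m : ℝ) ≤ Real.exp (m / 2) :=
  le_trans (Nat.cast_le.2 (min_le_right _ _)) (Nat.floor_le (Real.exp_pos _).le)

end Cycles

/-! ### Forcing a lower bound on `S` at the start of a cycle -/

section CycleStart

variable {ψ : ℝ → ℝ} {C a : ℝ} {ω : Path} {m n n₀ i : ℕ}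

/-- At the start of each cycle of the `m`-th level, `S` is at least `-(m + 4) * A`. -/
def CycleStartBound (ψ : ℝ → ℝ) (m : ℕ) (ω : Path) : Prop :=
  ∀ q < cycleCount ψ m, ∀ n, cycleStart ψ m q ≤ ω.Asq n →
    (∀ i < n, ω.Asq i < cycleStart ψ m q) → -(m + 4) * √(cycleStart ψ m q) ≤ ω.S n

/-- The bets against a path that violates `CycleStartBound`. -/
noncomputable def startBet (ψ : ℝ → ℝ) (m : ℕ) : Path → ℕ → ℝ :=
  averageBet (Finset.range (cycleCount ψ m)) fun q =>
    expBet (-(√(cycleStart ψ m q))⁻¹) 0 (cycleStart ψ m q)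

lemma predictable_startBet (ψ : ℝ → ℝ) (m : ℕ) : Predictable (startBet ψ m) :=
  Predictable.averageBet fun _ => predictable_expBet _ _ _

lemma Path.Asq_succ_le_two_mul (hA : ω.Asq i ≤ a) (hc : ω.c i ≤ √a) :
    ω.Asq (i + 1) ≤ 2 * a := by
  have c_sq_le := pow_le_pow_left₀ (ω.c_nonneg i) hc 2
  rw [Real.sq_sqrt ((ω.Asq_nonneg i).trans hA)] at c_sq_le
  rw [ω.Asq_succ]
  linarith [ω.sq_x_le i]

lemma exp_sub_three_le_expCapital {K : ℝ} (ha : 0 < a) (hA : ∀ i < n, ω.Asq i < a)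
    (hc : ∀ i < n, ω.c i ≤ √a / 2) (hS : ω.S n ≤ -K * √a) :
    Real.exp (K - 3) ≤ expCapital (-(√a)⁻¹) 0 a ω n := by
  have sqrt_pos : 0 < √a := Real.sqrt_pos.2 ha
  have abs_eq : |(-(√a)⁻¹)| = (√a)⁻¹ := by rw [abs_neg, abs_of_pos (inv_pos.2 sqrt_pos)]
  have sq_eq : (-(√a)⁻¹) ^ 2 = a⁻¹ := by rw [neg_sq, inv_pow, Real.sq_sqrt ha.le]
  have stake_le (i : ℕ) (hi : i < n) : |(-(√a)⁻¹)| * ω.c i ≤ 1 / 2 := by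
    rw [abs_eq, inv_mul_le_iff₀ sqrt_pos]
    linarith [hc i hi]
  have variance_le : a⁻¹ * ω.Asq n ≤ 2 := by
    rw [inv_mul_le_iff₀ ha, mul_comm]
    rcases n with _ | k
    · simp [Path.Asq, ha.le]
    · exact Path.Asq_succ_le_two_mul (hA k k.lt_succ_self).le
        ((hc k k.lt_succ_self).trans (half_le_self sqrt_pos.le))
  have error_le : ∑ i ∈ Finset.range n,
      2 * (|(-(√a)⁻¹)| * ω.c i) * ((-(√a)⁻¹) ^ 2 * ω.x i ^ 2) ≤ a⁻¹ * ω.Asq n := by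
    rw [sq_eq, Path.Asq, Finset.mul_sum]
    refine Finset.sum_le_sum fun i hi => mul_le_of_le_one_left (by positivity) ?_
    linarith [stake_le i (Finset.mem_range.1 hi)]
  have gain : K ≤ -(√a)⁻¹ * ω.S n := by
    rw [neg_mul, ← mul_neg, le_inv_mul_iff₀ sqrt_pos]
    linarith
  refine le_trans (Real.exp_le_exp.2 ?_) (exp_le_expCapital hA stake_le)
  rw [sq_eq] at error_le ⊢
  linarith

lemma TailBound.c_le_half_sqrt (hω : TailBound ψ C n₀ ω)
    (ha : (2 * ∑ i ∈ Finset.range n₀, ω.c i) ^ 2 ≤ a) (hi : ω.Asq i ≤ a) : ω.c i ≤ √a / 2 := by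
  rcases lt_or_ge i n₀ with h | h
  · have c_le_sum : ω.c i ≤ ∑ i ∈ Finset.range n₀, ω.c i :=
      Finset.single_le_sum (fun k _ => ω.c_nonneg k) (Finset.mem_range.2 h)
    linarith [Real.le_sqrt_of_sq_le ha]
  · linarith [hω.c_le i h, Real.sqrt_le_sqrt hi, Real.sqrt_nonneg a]

lemma TailBound.reaches_startBet (hω : TailBound ψ C n₀ ω) (hψ : Tendsto ψ atTop atTop)
    (hm : (2 * ∑ i ∈ Finset.range n₀, ω.c i) ^ 2 ≤ threshold ψ m)
    (h : ¬ CycleStartBound ψ m ω) : Reaches (Real.exp (m / 2)) (startBet ψ m) ω := by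
  unfold CycleStartBound at h
  push Not at h
  obtain ⟨q, hq, n, -, before, S_lt⟩ := h
  have hq' := Finset.mem_range.2 hq
  have exp_le := exp_sub_three_le_expCapital (cycleStart_pos hψ m q) before (fun i hi =>
    hω.c_le_half_sqrt (hm.trans (threshold_le_cycleStart hψ m q)) (before i hi).le) S_lt.le
  refine ⟨n, ?_, fun i _ => prudent_averageBet ⟨q, hq'⟩ (fun _ => prudent_expBet _ _ _) ω i⟩
  refine le_trans ?_ (inv_card_mul_wealth_le_averageBet (fun _ => prudent_expBet _ _ _) hq' ω n)
  have count_pos : (0 : ℝ) < cycleCount ψ m := Nat.cast_pos.2 (q.zero_le.trans_lt hq)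
  rw [Finset.card_range, wealth_expBet, le_inv_mul_iff₀ count_pos]
  calc (cycleCount ψ m : ℝ) * Real.exp (m / 2) ≤ Real.exp (m / 2) * Real.exp (m / 2) :=
        mul_le_mul_of_nonneg_right (cycleCount_le_exp ψ m) (Real.exp_pos _).le
    _ ≤ Real.exp (m + 4 - 3) := by
        rw [← Real.exp_add]
        exact Real.exp_le_exp.2 (by linarith)
    _ ≤ _ := exp_le

theorem canForce_cycleStartBound {α : ℝ} (hα : 0 < α) (hψ : IsBarrier ψ) :
    CanForce α fun ω => Regular ψ ω → ∀ᶠ m in atTop, CycleStartBound ψ m ω := by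
  refine canForce_of_frequently_reaches hα (predictable_startBet ψ)
    (T := fun m => Real.exp (m / 2)) (fun m => Real.exp_pos _)
    (summable_exp_neg_nat_div (c := 4) (by norm_num)) ?_ fun ω hω => ?_
  · refine (Real.tendsto_exp_atTop.comp
      (tendsto_natCast_atTop_atTop.atTop_div_const four_pos)).congr fun m => ?_
    rw [← Real.exp_add, Function.comp_apply]
    ring_nf
  · push Not at hω
    obtain ⟨regular, frequently_bad⟩ := hω
    obtain ⟨C, n₀, tailBound⟩ := regular.exists_tailBound hψ
    exact (frequently_bad.and_eventually (hψ.tendsto_threshold.eventually_ge_atTop _)).mono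
      fun m hm => tailBound.reaches_startBet hψ.tendsto hm.2 hm.1

end CycleStart

/-! ### The gain from the cycles -/

section CycleCost

variable {ψ : ℝ → ℝ}

/-- The total weight `(m + 1) * exp (-(m + 1) / 2)` of the exponential capitals that Skeptic sells
in one cycle of the `m`-th level. -/
noncomputable def cycleCost (m : ℕ) : ℝ := (m + 1) * Real.exp (-(m + 1) / 2)

lemma cycleCost_nonneg (m : ℕ) : 0 ≤ cycleCost m := by
  unfold cycleCost
  positivity

lemma summable_cycleCost : Summable cycleCost := by
  refine Summable.of_nonneg_of_le cycleCost_nonneg (fun m => ?_)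
    ((summable_exp_neg_nat_div (c := 4) four_pos).mul_left 4)
  have linear_le : (m : ℝ) + 1 ≤ 4 * Real.exp ((m + 1) / 4) := by
    linarith [Real.add_one_le_exp (((m : ℝ) + 1) / 4)]
  calc cycleCost m ≤ 4 * Real.exp ((m + 1) / 4) * Real.exp (-(m + 1) / 2) :=
        mul_le_mul_of_nonneg_right linear_le (Real.exp_pos _).le
    _ = 4 * Real.exp (-(m + 1) / 4) := by
        rw [mul_assoc, ← Real.exp_add]
        ring_nf
    _ ≤ 4 * Real.exp (-(m : ℝ) / 4) := by
        gcongr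
        linarith

lemma mul_exp_le_two_mul_cycleCost (m : ℕ) :
    ((m : ℝ) + 1) * Real.exp (-m / 2) ≤ 2 * cycleCost m := by
  have exp_eq : Real.exp (-((m : ℝ) + 1) / 2) = Real.exp (-m / 2) * Real.exp (-1 / 2) := by
    rw [← Real.exp_add]
    ring_nf
  have half_le : 1 / 2 ≤ Real.exp (-1 / 2) := by linarith [Real.add_one_le_exp (-1 / 2)]
  have hpos : 0 ≤ ((m : ℝ) + 1) * Real.exp (-m / 2) := by positivity
  rw [cycleCost, exp_eq]
  linarith [mul_le_mul_of_nonneg_left half_le hpos]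

lemma one_le_floor_exp_mul_cycleCost {m : ℕ} (hm : 3 ≤ m) :
    1 ≤ (⌊Real.exp (m / 2)⌋₊ : ℝ) * cycleCost m := by
  have hm' : (3 : ℝ) ≤ m := Nat.ofNat_le_cast.2 hm
  have half_le_floor : Real.exp ((m : ℝ) / 2) / 2 ≤ ⌊Real.exp (m / 2)⌋₊ := by
    linarith [Nat.lt_floor_add_one (Real.exp ((m : ℝ) / 2)), Real.add_one_le_exp ((m : ℝ) / 2)]
  have exp_mul_exp : Real.exp ((m : ℝ) / 2) * Real.exp (-m / 2) = 1 := by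
    rw [← Real.exp_add, neg_div, add_neg_cancel, Real.exp_zero]
  calc (1 : ℝ) ≤ (m + 1) / 4 := by linarith
    _ = Real.exp (m / 2) / 2 * ((m + 1) * Real.exp (-m / 2) / 2) := by
        linear_combination (-(m + 1) / 4 : ℝ) * exp_mul_exp
    _ ≤ Real.exp (m / 2) / 2 * cycleCost m := by
        gcongr
        linarith [mul_exp_le_two_mul_cycleCost m]
    _ ≤ _ := mul_le_mul_of_nonneg_right half_le_floor (cycleCost_nonneg m)

lemma cycleCount_eq_floor {m : ℕ} (hm : 3 ≤ m) (h : cycleCount ψ m * cycleCost m < 1) :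
    cycleCount ψ m = ⌊logLength ψ m / (2 * √(m + 1))⌋₊ :=
  (min_choice _ _).resolve_right fun count_eq =>
    h.not_ge ((one_le_floor_exp_mul_cycleCost hm).trans_eq (by rw [cycleCount, count_eq]))

lemma not_summable_cycleCount_mul_cycleCost (hψ : Tendsto ψ atTop atTop)
    (h : ¬ Summable fun m : ℕ => √(m + 1) * Real.exp (-m / 2) * logLength ψ m) :
    ¬ Summable fun m : ℕ => cycleCount ψ m * cycleCost m := by
  refine fun hs => h (((hs.add summable_cycleCost).mul_left 4).of_norm_bounded_eventually_nat ?_)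
  filter_upwards [hs.tendsto_atTop_zero.eventually_lt_const one_pos, eventually_ge_atTop 3]
    with m hlt hm
  set D := √((m : ℝ) + 1)
  have D_sq : D ^ 2 = m + 1 := Real.sq_sqrt (by positivity)
  have logLength_le : logLength ψ m ≤ (cycleCount ψ m + 1) * (2 * D) := by
    rw [cycleCount_eq_floor hm hlt, ← div_le_iff₀ (by positivity)]
    exact (Nat.lt_floor_add_one _).le
  rw [Real.norm_of_nonneg (mul_nonneg (by positivity) (logLength_nonneg hψ m))]
  calc D * Real.exp (-m / 2) * logLength ψ m
      ≤ D * Real.exp (-m / 2) * ((cycleCount ψ m + 1) * (2 * D)) :=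
        mul_le_mul_of_nonneg_left logLength_le (by positivity)
    _ = 2 * (cycleCount ψ m + 1) * ((m + 1) * Real.exp (-m / 2)) := by rw [← D_sq]; ring
    _ ≤ 2 * (cycleCount ψ m + 1) * (2 * cycleCost m) :=
        mul_le_mul_of_nonneg_left (mul_exp_le_two_mul_cycleCost m) (by positivity)
    _ = 4 * (cycleCount ψ m * cycleCost m + cycleCost m) := by ring

lemma exists_le_sum_Ico_of_not_summable {f : ℕ → ℝ} (hf : ∀ m, 0 ≤ f m) (h : ¬ Summable f)
    (m₀ : ℕ) (T : ℝ) : ∃ M, T ≤ ∑ m ∈ Finset.Ico m₀ M, f m := by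
  obtain ⟨M, sum_ge, hM⟩ := ((((not_summable_iff_tendsto_nat_atTop_of_nonneg hf).1
    h).eventually_ge_atTop (T + ∑ m ∈ Finset.range m₀, f m)).and (eventually_ge_atTop m₀)).exists
  exact ⟨M, by linarith [Finset.sum_Ico_eq_sub f hM]⟩

end CycleCost

/-! ### Sums of exponentials over a grid -/

lemma abs_log_le_two_mul_abs_sub_one {ρ : ℝ} (hρ : 1 / 2 ≤ ρ) : |Real.log ρ| ≤ 2 * |ρ - 1| := by
  have hρ0 : 0 < ρ := by linarith
  rcases le_total 1 ρ with h1 | h1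
  · rw [abs_of_nonneg (Real.log_nonneg h1), abs_of_nonneg (by linarith)]
    linarith [Real.log_le_sub_one_of_pos hρ0]
  · rw [abs_of_nonpos (Real.log_nonpos hρ0.le h1), abs_of_nonpos (by linarith)]
    have inv_le_two : ρ⁻¹ ≤ 2 := by rw [inv_le_comm₀ hρ0 two_pos]; linarith
    have inv_sub_one : ρ⁻¹ - 1 = ρ⁻¹ * (1 - ρ) := by rw [mul_sub, mul_one, inv_mul_cancel₀ hρ0.ne']
    linarith [Real.one_sub_inv_le_log_of_pos hρ0,
      mul_le_mul_of_nonneg_right inv_le_two (sub_nonneg.2 h1)]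

lemma exp_neg_sq_le {D ρ : ℝ} (hD : 0 ≤ D) :
    Real.exp (-(D ^ 2 * (ρ - 1) ^ 2 / 2)) ≤
      Real.exp 8 * Real.exp (-|2 * D * Real.log ρ|) + Real.exp (-D ^ 2 / 8) := by
  rw [← Real.exp_add]
  rcases lt_or_ge ρ (1 / 2) with h | h
  · refine le_trans (Real.exp_le_exp.2 ?_) (le_add_of_nonneg_left (Real.exp_pos _).le)
    have quarter_le : (1 / 2) ^ 2 ≤ (ρ - 1) ^ 2 := by nlinarith
    linarith [mul_le_mul_of_nonneg_left quarter_le (sq_nonneg D)]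
  · refine le_trans (Real.exp_le_exp.2 ?_) (le_add_of_nonneg_right (Real.exp_pos _).le)
    have log_le : |2 * D * Real.log ρ| ≤ 4 * (D * |ρ - 1|) := by
      rw [abs_mul, abs_of_nonneg (by positivity : 0 ≤ 2 * D)]
      linarith [mul_le_mul_of_nonneg_left (abs_log_le_two_mul_abs_sub_one h) hD]
    have sq_eq : (D * |ρ - 1|) ^ 2 = D ^ 2 * (ρ - 1) ^ 2 := by rw [mul_pow, sq_abs]
    nlinarith [sq_nonneg (D * |ρ - 1| - 4)]

lemma exp_neg_abs_sub_le (y : ℝ) (k : ℕ) :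
    Real.exp (-|y - k|) ≤ Real.exp 1 * Real.exp (-|((⌊y⌋ - (k : ℤ) : ℤ) : ℝ)|) := by
  rw [← Real.exp_add]
  refine Real.exp_le_exp.2 ?_
  push_cast
  have floor_sub_le : |(⌊y⌋ : ℝ) - y| ≤ 1 :=
    abs_le.2 ⟨by linarith [Int.lt_floor_add_one y], by linarith [Int.floor_le y]⟩
  linarith [abs_sub_le (⌊y⌋ : ℝ) y k]

lemma exists_sum_exp_neg_abs_sub_le :
    ∃ G : ℝ, ∀ (y : ℝ) (J : ℕ), ∑ k ∈ Finset.range J, Real.exp (-|y - k|) ≤ G := by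
  have hs : Summable fun j : ℤ => Real.exp (-|(j : ℝ)|) := by
    have summable_nat : Summable fun n : ℕ => Real.exp (-(n : ℝ) / 1) :=
      summable_exp_neg_nat_div one_pos
    refine Summable.of_nat_of_neg ?_ ?_ <;> exact summable_nat.congr fun n => by simp
  refine ⟨Real.exp 1 * ∑' j : ℤ, Real.exp (-|(j : ℝ)|), fun y J => ?_⟩
  calc ∑ k ∈ Finset.range J, Real.exp (-|y - k|)
      ≤ ∑ k ∈ Finset.range J, Real.exp 1 * Real.exp (-|((⌊y⌋ - (k : ℤ) : ℤ) : ℝ)|) :=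
        Finset.sum_le_sum fun k _ => exp_neg_abs_sub_le y k
    _ = Real.exp 1 * ∑ j ∈ (Finset.range J).image (fun k : ℕ => ⌊y⌋ - (k : ℤ)),
          Real.exp (-|(j : ℝ)|) := by
        rw [← Finset.mul_sum, Finset.sum_image]
        exact fun a _ b _ hab => Nat.cast_injective (sub_right_injective hab)
    _ ≤ _ := mul_le_mul_of_nonneg_left
        (hs.sum_le_tsum _ fun j _ => (Real.exp_pos _).le) (Real.exp_pos _).le

/-! ### The capitals sold in a cycle -/

section Lower

variable {ψ : ℝ → ℝ} {B C a b l ε : ℝ} {ω : Path} {k m M m₀ n n₀ n₁ q : ℕ}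

/-- The values of `A²` at which the exponential capitals sold in the `q`-th cycle of the `m`-th
level peak. -/
noncomputable def cycleGridPoint (ψ : ℝ → ℝ) (m q k : ℕ) : ℝ :=
  cycleStart ψ m q * (4 * (m + 1) ^ 3) * Real.exp (k / √(m + 1))

/-- The fraction of the capital that makes an exponential capital peak at
`cycleGridPoint ψ m q k` on a path with `S = √(m + 1) * A`. -/
noncomputable def cycleFraction (ψ : ℝ → ℝ) (m q k : ℕ) : ℝ :=
  √(m + 1) / √(cycleGridPoint ψ m q k)

/-- The `k`-th of the exponential capitals sold in the `q`-th cycle of the `m`-th level. -/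
noncomputable def cycleCapital (ψ : ℝ → ℝ) (m q k : ℕ) : Path → ℕ → ℝ :=
  expCapital (cycleFraction ψ m q k) (cycleStart ψ m q) (16 * cycleGridPoint ψ m q k)

/-- Levels that are large enough, in terms of `C`, for all estimates within a cycle. -/
structure LargeLevel (C : ℝ) (m : ℕ) : Prop where
  one_le : 1 ≤ m
  bet_small : 64 * C ≤ m + 1
  grid_fits : 68 * ((m : ℝ) + 1) ^ 3 ≤ Real.exp √(m + 1)
  decay : 272 * C ≤ m

/-- Paths on which Skeptic gains by selling in the cycles of the `m`-th level. -/
structure LowerPath (ψ : ℝ → ℝ) (C : ℝ) (n₀ m : ℕ) (ω : Path) : Prop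
    extends TailBound ψ C n₀ ω, LargeLevel C m where
  S_lt : ∀ n, n₀ ≤ n → ω.S n < ω.A n * ψ (ω.Asq n)
  started : ω.Asq n₀ < threshold ψ m
  startBound : CycleStartBound ψ m ω

lemma eventually_largeLevel (C : ℝ) : ∀ᶠ m in atTop, LargeLevel C m := by
  have sqrt_tendsto : Tendsto (fun m : ℕ => √((m : ℝ) + 1)) atTop atTop :=
    Real.tendsto_sqrt_atTop.comp (tendsto_atTop_add_const_right _ _ tendsto_natCast_atTop_atTop)
  filter_upwards [eventually_ge_atTop 1,
    tendsto_natCast_atTop_atTop.eventually_ge_atTop (64 * C),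
    tendsto_natCast_atTop_atTop.eventually_ge_atTop (272 * C),
    ((Real.tendsto_exp_div_pow_atTop 6).comp sqrt_tendsto).eventually_ge_atTop 68]
    with m one_le h64 h272 exp_ge
  have sqrt_pow : √((m : ℝ) + 1) ^ 6 = ((m : ℝ) + 1) ^ 3 := by
    rw [show 6 = 2 * 3 by norm_num, pow_mul, Real.sq_sqrt (by positivity)]
  rw [Function.comp_apply, sqrt_pow, le_div_iff₀ (by positivity)] at exp_ge
  exact ⟨one_le, h64.trans (by linarith), exp_ge, h272⟩

lemma cycleGridPoint_pos (hψ : Tendsto ψ atTop atTop) (m q k : ℕ) : 0 < cycleGridPoint ψ m q k :=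
  mul_pos (mul_pos (cycleStart_pos hψ m q) (by positivity)) (Real.exp_pos _)

lemma cycleStart_mul_le_cycleGridPoint (hψ : Tendsto ψ atTop atTop) (m q k : ℕ) :
    cycleStart ψ m q * (4 * (m + 1) ^ 3) ≤ cycleGridPoint ψ m q k :=
  le_mul_of_one_le_right (mul_pos (cycleStart_pos hψ m q) (by positivity)).le
    (Real.one_le_exp (by positivity))

lemma four_mul_cycleStart_le_cycleGridPoint (hψ : Tendsto ψ atTop atTop) (m q k : ℕ) :
    4 * (m + 1) * cycleStart ψ m q ≤ cycleGridPoint ψ m q k := by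
  refine le_trans ?_ (cycleStart_mul_le_cycleGridPoint hψ m q k)
  have le_pow : (m : ℝ) + 1 ≤ (m + 1) ^ 3 :=
    le_self_pow₀ (le_add_of_nonneg_left m.cast_nonneg) three_ne_zero
  linarith [mul_le_mul_of_nonneg_left le_pow (cycleStart_pos hψ m q).le]

lemma LargeLevel.mul_cycleGridPoint_lt (hm : LargeLevel C m) (hψ : Tendsto ψ atTop atTop)
    (q : ℕ) (hk : k < m + 1) : 17 * cycleGridPoint ψ m q k < cycleStart ψ m (q + 1) := by
  rw [cycleGridPoint, cycleStart_succ, two_mul, Real.exp_add]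
  have exp_lt : Real.exp (k / √((m : ℝ) + 1)) < Real.exp √(m + 1) := by
    rw [Real.exp_lt_exp, div_lt_iff₀ (by positivity), Real.mul_self_sqrt (by positivity)]
    exact_mod_cast hk
  calc 17 * (cycleStart ψ m q * (4 * (m + 1) ^ 3) * Real.exp (k / √(m + 1)))
      = cycleStart ψ m q * (68 * ((m : ℝ) + 1) ^ 3 * Real.exp (k / √(m + 1))) := by ring
    _ < cycleStart ψ m q * (Real.exp √(m + 1) * Real.exp √(m + 1)) :=
        mul_lt_mul_of_pos_left
          (mul_lt_mul' hm.grid_fits exp_lt (Real.exp_pos _).le (Real.exp_pos _))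
          (cycleStart_pos hψ m q)

lemma cycleFraction_pos (hψ : Tendsto ψ atTop atTop) (m q k : ℕ) : 0 < cycleFraction ψ m q k :=
  div_pos (Real.sqrt_pos.2 (by positivity)) (Real.sqrt_pos.2 (cycleGridPoint_pos hψ m q k))

lemma cycleFraction_sq_mul (hψ : Tendsto ψ atTop atTop) (m q k : ℕ) :
    cycleFraction ψ m q k ^ 2 * cycleGridPoint ψ m q k = m + 1 := by
  have hpos := cycleGridPoint_pos hψ m q k
  rw [cycleFraction, div_pow, Real.sq_sqrt hpos.le, Real.sq_sqrt (by positivity),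
    div_mul_cancel₀ _ hpos.ne']

/-! ### The course of a cycle -/

lemma Path.exists_first (h : a ≤ ω.Asq n) : ∃ k ≤ n, a ≤ ω.Asq k ∧ ∀ i < k, ω.Asq i < a := by
  classical
  have hex : ∃ k, a ≤ ω.Asq k := ⟨n, h⟩
  exact ⟨Nat.find hex, Nat.find_min' hex h, Nat.find_spec hex,
    fun i hi => not_le.1 (Nat.find_min hex hi)⟩

lemma TailBound.Asq_le_of_forall_lt (hω : TailBound ψ C n₀ ω) (hn : n₀ < n)
    (hb : ∀ i < n, ω.Asq i < b) : ω.Asq n ≤ 17 / 16 * b := by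
  obtain ⟨i, rfl⟩ : ∃ i, n = i + 1 := ⟨n - 1, by lia⟩
  have c_sq_le := pow_le_pow_left₀ (ω.c_nonneg i) (hω.c_le i (Nat.le_of_lt_succ hn)) 2
  rw [div_pow, Real.sq_sqrt (ω.Asq_nonneg i)] at c_sq_le
  rw [ω.Asq_succ]
  linarith [ω.sq_x_le i, ω.Asq_nonneg i, hb i i.lt_succ_self]

lemma Path.exists_exit (hn : n₁ ≤ n) (hb : ∀ i < n₁, ω.Asq i < b) :
    ∃ n₂, n₁ ≤ n₂ ∧ n₂ ≤ n ∧ (∀ i < n₂, ω.Asq i < b) ∧ (∀ i, n₂ ≤ i → i < n → b ≤ ω.Asq i) ∧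
      (n₂ = n ∨ b ≤ ω.Asq n₂) := by
  rcases lt_or_ge (ω.Asq n) b with h | h
  · exact ⟨n, hn, le_rfl, fun i hi => (ω.Asq_mono hi.le).trans_lt h,
      fun i hni hin => absurd hin hni.not_gt, Or.inl rfl⟩
  · obtain ⟨n₂, hn₂, exited, before⟩ := ω.exists_first h
    exact ⟨n₂, not_lt.1 fun hlt => (hb n₂ hlt).not_ge exited, hn₂, before,
      fun i hi _ => exited.trans (ω.Asq_mono hi), Or.inr exited⟩

lemma neg_two_le_cycleFraction_mul_S (hψ : Tendsto ψ atTop atTop) (hm : 1 ≤ m)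
    (hS : -(m + 4) * √(cycleStart ψ m q) ≤ ω.S n) : -2 ≤ cycleFraction ψ m q k * ω.S n := by
  set D := √((m : ℝ) + 1)
  have D_sq : D ^ 2 = m + 1 := Real.sq_sqrt (by positivity)
  have one_le : (1 : ℝ) ≤ m := Nat.one_le_cast.2 hm
  have start_le : √(cycleStart ψ m q) * (2 * (D * (m + 1))) ≤ √(cycleGridPoint ψ m q k) := by
    refine Real.le_sqrt_of_sq_le (Eq.trans_le ?_ (cycleStart_mul_le_cycleGridPoint hψ m q k))
    rw [mul_pow, mul_pow, mul_pow, Real.sq_sqrt (cycleStart_pos hψ m q).le, D_sq]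
    ring
  have le_two : cycleFraction ψ m q k * ((m + 4) * √(cycleStart ψ m q)) ≤ 2 := by
    rw [cycleFraction, div_mul_eq_mul_div,
      div_le_iff₀ (Real.sqrt_pos.2 (cycleGridPoint_pos hψ m q k))]
    have hpos : 0 ≤ √(cycleStart ψ m q) * D := by positivity
    nlinarith [mul_le_mul_of_nonneg_left one_le hpos]
  linarith [mul_le_mul_of_nonneg_left hS (cycleFraction_pos hψ m q k).le]

lemma cycleFraction_sq_mul_Asq_le_one (hψ : Tendsto ψ atTop atTop)
    (hA : ω.Asq n ≤ 17 / 16 * cycleStart ψ m q) : cycleFraction ψ m q k ^ 2 * ω.Asq n ≤ 1 := by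
  have hm : (0 : ℝ) < m + 1 := by positivity
  have four_mul_le : ((m : ℝ) + 1) * (4 * ω.Asq n) ≤ 2 * cycleGridPoint ψ m q k := by
    have := cycleStart_pos hψ m q
    nlinarith [four_mul_cycleStart_le_cycleGridPoint hψ m q k]
  have := mul_le_mul_of_nonneg_left four_mul_le (sq_nonneg (cycleFraction ψ m q k))
  refine le_of_mul_le_mul_left (?_ : ((m : ℝ) + 1) * _ ≤ (m + 1) * 1) hm
  linarith [cycleFraction_sq_mul hψ m q k]

namespace LowerPath

lemma exists_entry (hω : LowerPath ψ C n₀ m ω) (hψ : Tendsto ψ atTop atTop)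
    (hq : q < cycleCount ψ m) (hn : cycleStart ψ m q ≤ ω.Asq n) :
    ∃ n₁ ≤ n, n₀ < n₁ ∧ cycleStart ψ m q ≤ ω.Asq n₁ ∧ (∀ i < n₁, ω.Asq i < cycleStart ψ m q) ∧
      -(m + 4) * √(cycleStart ψ m q) ≤ ω.S n₁ := by
  obtain ⟨n₁, hn₁, entered, before⟩ := ω.exists_first hn
  refine ⟨n₁, hn₁, not_le.1 fun hle => ?_, entered, before, hω.startBound q hq n₁ entered before⟩
  exact (entered.trans (ω.Asq_mono hle)).not_gt
    (hω.started.trans_le (threshold_le_cycleStart hψ m q))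

lemma cycleFraction_mul_S_le (hω : LowerPath ψ C n₀ m ω) (hψ : IsBarrier ψ)
    (hq : q < cycleCount ψ m) (hk : k < m + 1) (hn : n₀ ≤ n)
    (hA : ω.Asq n ≤ 17 * cycleGridPoint ψ m q k) :
    cycleFraction ψ m q k * ω.S n ≤ (m + 1) * (√(ω.Asq n) / √(cycleGridPoint ψ m q k)) := by
  have Asq_lt : ω.Asq n < threshold ψ (m + 1) :=
    (hA.trans_lt (hω.mul_cycleGridPoint_lt hψ.tendsto q hk)).trans_le
      (cycleStart_succ_le_threshold hψ.tendsto hq)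
  have psi_le : ψ (ω.Asq n) ≤ √(m + 1) :=
    (le_sqrt_of_lt_threshold (hω.one_le_Asq n hn) Asq_lt).trans_eq (by push_cast; rfl)
  have S_le : ω.S n ≤ √(ω.Asq n) * √(m + 1) :=
    (hω.S_lt n hn).le.trans (mul_le_mul_of_nonneg_left psi_le (Real.sqrt_nonneg _))
  refine (mul_le_mul_of_nonneg_left S_le (cycleFraction_pos hψ.tendsto m q k).le).trans_eq ?_
  have D_sq : √((m : ℝ) + 1) ^ 2 = m + 1 := Real.sq_sqrt (by positivity)
  rw [cycleFraction]
  linear_combination (√(ω.Asq n) / √(cycleGridPoint ψ m q k)) * D_sq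

lemma abs_cycleFraction_mul_c_le (hω : LowerPath ψ C n₀ m ω) (hψ : IsBarrier ψ) {i : ℕ}
    (hi : n₀ ≤ i) (h1 : cycleStart ψ m q ≤ ω.Asq i) (h2 : ω.Asq i ≤ 16 * cycleGridPoint ψ m q k) :
    |cycleFraction ψ m q k| * ω.c i ≤ 32 * C / (m + 1) := by
  have hm : (1 : ℝ) ≤ m := Nat.one_le_cast.2 hω.one_le
  have sqrt_le : √(ω.Asq i) ≤ 4 * √(cycleGridPoint ψ m q k) := by
    rw [Real.sqrt_le_left (by positivity), mul_pow,
      Real.sq_sqrt (cycleGridPoint_pos hψ.tendsto m q k).le]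
    linarith
  rw [abs_of_pos (cycleFraction_pos hψ.tendsto m q k)]
  refine (hω.sqrt_div_sqrt_mul_c_le hψ hi (by positivity) (k := m) (by linarith)
    ((threshold_le_cycleStart hψ.tendsto m q).trans h1)
    (cycleGridPoint_pos hψ.tendsto m q k) sqrt_le).trans_eq (by ring)

lemma exponent_le (hω : LowerPath ψ C n₀ m ω) (hψ : IsBarrier ψ) {n₂ : ℕ}
    (hq : q < cycleCount ψ m) (hk : k < m + 1) (hn : n₀ ≤ n₂)
    (hS : -(m + 4) * √(cycleStart ψ m q) ≤ ω.S n₁)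
    (hA₁ : ω.Asq n₁ ≤ 17 / 16 * cycleStart ψ m q)
    (hA₂ : ω.Asq n₂ ≤ 17 * cycleGridPoint ψ m q k) :
    cycleFraction ψ m q k * (ω.S n₂ - ω.S n₁) -
        cycleFraction ψ m q k ^ 2 * (1 / 2 - 2 * (32 * C / (m + 1))) * (ω.Asq n₂ - ω.Asq n₁) ≤
      3 + 1088 * C + ((m : ℝ) + 1) / 2 -
        (m + 1) * (√(ω.Asq n₂) / √(cycleGridPoint ψ m q k) - 1) ^ 2 / 2 := by
  have S₂_le := hω.cycleFraction_mul_S_le hψ hq hk hn hA₂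
  have le_S₁ := neg_two_le_cycleFraction_mul_S (k := k) hψ.tendsto hω.one_le hS
  have Asq₁_le := cycleFraction_sq_mul_Asq_le_one (k := k) hψ.tendsto hA₁
  have grid_eq := cycleFraction_sq_mul hψ.tendsto m q k
  set γ := cycleFraction ψ m q k
  set l := cycleGridPoint ψ m q k
  have hl : 0 < l := cycleGridPoint_pos hψ.tendsto m q k
  set η := 32 * C / (m + 1) with hη
  have η_nonneg : 0 ≤ η := div_nonneg (mul_nonneg (by norm_num) hω.nonneg) (by positivity)
  have Asq₂_eq : γ ^ 2 * ω.Asq n₂ = (m + 1) * (√(ω.Asq n₂) / √l) ^ 2 := by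
    rw [div_pow, Real.sq_sqrt (ω.Asq_nonneg n₂), Real.sq_sqrt hl.le, ← grid_eq, mul_assoc,
      mul_div_cancel₀ _ hl.ne']
  have error_le : 2 * η * (γ ^ 2 * ω.Asq n₂) ≤ 1088 * C :=
    calc 2 * η * (γ ^ 2 * ω.Asq n₂) ≤ 2 * η * (γ ^ 2 * (17 * l)) := by gcongr
      _ = 34 * (η * (γ ^ 2 * l)) := by ring
      _ = 1088 * C := by
          rw [grid_eq, hη, div_mul_cancel₀ _ (by positivity)]
          ring
  have error_nonneg : 0 ≤ η * (γ ^ 2 * ω.Asq n₁) :=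
    mul_nonneg η_nonneg (mul_nonneg (sq_nonneg γ) (ω.Asq_nonneg n₁))
  set ρ := √(ω.Asq n₂) / √l
  linarith

lemma exists_cycleCapital_le (hω : LowerPath ψ C n₀ m ω) (hψ : IsBarrier ψ)
    (hq : q < cycleCount ψ m) (hk : k < m + 1) (hn : cycleStart ψ m q ≤ ω.Asq n) :
    ∃ n₂, (n₂ = n ∨ 16 * cycleGridPoint ψ m q k ≤ ω.Asq n₂) ∧ 0 < ω.Asq n₂ ∧
      cycleCapital ψ m q k ω n ≤ Real.exp (3 + 1088 * C + ((m : ℝ) + 1) / 2 -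
        (m + 1) * (√(ω.Asq n₂) / √(cycleGridPoint ψ m q k) - 1) ^ 2 / 2) := by
  have start_pos := cycleStart_pos hψ.tendsto m q
  have start_le : cycleStart ψ m q ≤ 16 * cycleGridPoint ψ m q k := by
    have := mul_nonneg m.cast_nonneg start_pos.le
    linarith [four_mul_cycleStart_le_cycleGridPoint hψ.tendsto m q k]
  obtain ⟨n₁, hn₁, hn₀, entered, before_entry, hS⟩ := hω.exists_entry hψ.tendsto hq hn
  obtain ⟨n₂, h12, h2n, before_exit, after_exit, exit⟩ :=
    Path.exists_exit hn₁ fun i hi => (before_entry i hi).trans_le start_le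
  have η_le : 32 * C / (m + 1) ≤ 1 / 2 := by
    rw [div_le_iff₀ (by positivity)]
    linarith [hω.bet_small]
  have start_le_Asq {i : ℕ} (hi : n₁ ≤ i) : cycleStart ψ m q ≤ ω.Asq i :=
    entered.trans (ω.Asq_mono hi)
  refine ⟨n₂, exit, start_pos.trans_le (start_le_Asq h12), ?_⟩
  refine (expCapital_le_exp h12 h2n before_entry after_exit
    (fun i h1i hi2 => ⟨start_le_Asq h1i, before_exit i hi2⟩) η_le
    (fun i h1i hi2 => hω.abs_cycleFraction_mul_c_le hψ (hn₀.le.trans h1i) (start_le_Asq h1i)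
      (before_exit i hi2).le)).trans (Real.exp_le_exp.2 ?_)
  refine hω.exponent_le hψ hq hk (hn₀.le.trans h12) hS
    (hω.Asq_le_of_forall_lt hn₀ before_entry) ?_
  linarith [hω.Asq_le_of_forall_lt (hn₀.trans_le h12) before_exit]

end LowerPath

/-! ### The debt of a cycle -/

/-- The current value of the exponential capitals sold in the `q`-th cycle of the `m`-th level. -/
noncomputable def cycleDebt (ψ : ℝ → ℝ) (m q : ℕ) (ω : Path) (n : ℕ) : ℝ :=
  ∑ k ∈ Finset.range (m + 1), Real.exp (-(m + 1) / 2) * cycleCapital ψ m q k ω n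

/-- The debt of a cycle never exceeds `B`. -/
def CycleDebtBound (ψ : ℝ → ℝ) (C B : ℝ) : Prop :=
  ∀ ⦃n₀ m q n : ℕ⦄ ⦃ω : Path⦄, LowerPath ψ C n₀ m ω → q < cycleCount ψ m →
    cycleStart ψ m q ≤ ω.Asq n → cycleDebt ψ m q ω n ≤ B

lemma cycleCost_eq_sum (m : ℕ) :
    cycleCost m = ∑ _k ∈ Finset.range (m + 1), Real.exp (-((m : ℝ) + 1) / 2) := by
  rw [Finset.sum_const, Finset.card_range, nsmul_eq_mul, cycleCost, Nat.cast_succ]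

lemma cycleDebt_eq_cycleCost (h : ω.Asq n < cycleStart ψ m q) :
    cycleDebt ψ m q ω n = cycleCost m := by
  simp only [cycleDebt, cycleCapital, expCapital_eq_one h, mul_one, cycleCost_eq_sum]

lemma nine_le_sq_sqrt_div_sub_one {t : ℝ} (hl : 0 < l) (h : 16 * l ≤ t) :
    9 ≤ (√t / √l - 1) ^ 2 := by
  have four_le : 4 ≤ √t / √l := by
    rw [le_div_iff₀ (Real.sqrt_pos.2 hl)]
    refine Real.le_sqrt_of_sq_le ?_
    rw [mul_pow, Real.sq_sqrt hl.le]
    linarith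
  nlinarith

lemma LowerPath.cycleDebt_le_half_cycleCost (hω : LowerPath ψ C n₀ m ω) (hψ : IsBarrier ψ)
    (hq : q < cycleCount ψ m) (hn : cycleStart ψ m (q + 1) ≤ ω.Asq n) :
    cycleDebt ψ m q ω n ≤ cycleCost m / 2 := by
  rw [cycleCost_eq_sum, Finset.sum_div]
  refine Finset.sum_le_sum fun k hk => ?_
  refine (mul_le_mul_of_nonneg_left ?_ (Real.exp_pos _).le).trans_eq (mul_one_div _ 2)
  have hk' := Finset.mem_range.1 hk
  have hl := cycleGridPoint_pos hψ.tendsto m q k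
  obtain ⟨n₂, hn₂, -, capital_le⟩ := hω.exists_cycleCapital_le hψ hq hk'
    ((cycleStart_mono hψ.tendsto m q.le_succ).trans hn)
  have exited : 16 * cycleGridPoint ψ m q k ≤ ω.Asq n₂ := by
    rcases hn₂ with rfl | h
    · linarith [hω.mul_cycleGridPoint_lt hψ.tendsto q hk']
    · exact h
  refine capital_le.trans ((Real.exp_le_exp.2 ?_).trans Real.exp_neg_one_lt_half.le)
  have := mul_le_mul_of_nonneg_left (nine_le_sq_sqrt_div_sub_one hl exited)
    (by positivity : (0 : ℝ) ≤ m + 1)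
  linarith [hω.decay]

lemma two_mul_sqrt_mul_log_sqrt_div {t : ℝ} (hψ : Tendsto ψ atTop atTop) (ht : 0 < t)
    (m q k : ℕ) : 2 * √((m : ℝ) + 1) * Real.log (√t / √(cycleGridPoint ψ m q k)) =
      √((m : ℝ) + 1) * (Real.log t - Real.log (cycleStart ψ m q * (4 * (m + 1) ^ 3))) - k := by
  have hl := cycleGridPoint_pos hψ m q k
  have base_pos : 0 < cycleStart ψ m q * (4 * ((m : ℝ) + 1) ^ 3) :=
    mul_pos (cycleStart_pos hψ m q) (by positivity)
  rw [Real.log_div (Real.sqrt_pos.2 ht).ne' (Real.sqrt_pos.2 hl).ne', Real.log_sqrt ht.le,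
    Real.log_sqrt hl.le, cycleGridPoint, Real.log_mul base_pos.ne' (Real.exp_pos _).ne',
    Real.log_exp]
  field_simp
  ring

lemma LowerPath.exp_mul_cycleCapital_le (hω : LowerPath ψ C n₀ m ω) (hψ : IsBarrier ψ)
    (hq : q < cycleCount ψ m) (hk : k < m + 1) (hn : cycleStart ψ m q ≤ ω.Asq n) :
    Real.exp (-(m + 1) / 2) * cycleCapital ψ m q k ω n ≤
      Real.exp (3 + 1088 * C) * (Real.exp 8 * Real.exp (-|√((m : ℝ) + 1) *
        (Real.log (ω.Asq n) - Real.log (cycleStart ψ m q * (4 * (m + 1) ^ 3))) - k|) +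
          Real.exp (-(m + 1) / 8)) := by
  have D_sq : √((m : ℝ) + 1) ^ 2 = m + 1 := Real.sq_sqrt (by positivity)
  obtain ⟨n₂, hn₂, Asq_pos, capital_le⟩ := hω.exists_cycleCapital_le hψ hq hk hn
  calc Real.exp (-(m + 1) / 2) * cycleCapital ψ m q k ω n
      ≤ Real.exp (-(m + 1) / 2) * Real.exp (3 + 1088 * C + ((m : ℝ) + 1) / 2 -
          (m + 1) * (√(ω.Asq n₂) / √(cycleGridPoint ψ m q k) - 1) ^ 2 / 2) :=
        mul_le_mul_of_nonneg_left capital_le (Real.exp_pos _).le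
    _ = Real.exp (3 + 1088 * C) *
          Real.exp (-((m + 1) * (√(ω.Asq n₂) / √(cycleGridPoint ψ m q k) - 1) ^ 2 / 2)) := by
        rw [← Real.exp_add, ← Real.exp_add]
        ring_nf
    _ ≤ _ := mul_le_mul_of_nonneg_left ?_ (Real.exp_pos _).le
  rcases hn₂ with rfl | exited
  · rw [← two_mul_sqrt_mul_log_sqrt_div hψ.tendsto Asq_pos]
    simpa only [D_sq] using exp_neg_sq_le (Real.sqrt_nonneg ((m : ℝ) + 1))
      (ρ := √(ω.Asq n₂) / √(cycleGridPoint ψ m q k))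
  · refine le_trans (Real.exp_le_exp.2 ?_) (le_add_of_nonneg_left (by positivity))
    have hm : (0 : ℝ) ≤ m + 1 := by positivity
    linarith [mul_le_mul_of_nonneg_left
      (nine_le_sq_sqrt_div_sub_one (cycleGridPoint_pos hψ.tendsto m q k) exited) hm]

lemma exists_cycleDebtBound (hψ : IsBarrier ψ) (C : ℝ) : ∃ B > 0, CycleDebtBound ψ C B := by
  obtain ⟨G, hG⟩ := exists_sum_exp_neg_abs_sub_le
  have G_nonneg : 0 ≤ G := by simpa using hG 0 0
  refine ⟨Real.exp (3 + 1088 * C) * (Real.exp 8 * G + 8), by positivity, ?_⟩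
  intro n₀ m q n ω hω hq hn
  have remainder_le : ((m + 1 : ℕ) : ℝ) * Real.exp (-(m + 1) / 8) ≤ 8 :=
    calc ((m + 1 : ℕ) : ℝ) * Real.exp (-(m + 1) / 8)
        ≤ 8 * Real.exp ((m + 1) / 8) * Real.exp (-(m + 1) / 8) := by
          refine mul_le_mul_of_nonneg_right ?_ (Real.exp_pos _).le
          push_cast
          linarith [Real.add_one_le_exp (((m : ℝ) + 1) / 8)]
      _ = 8 := by
          rw [mul_assoc, ← Real.exp_add, neg_div, add_neg_cancel, Real.exp_zero, mul_one]
  refine (Finset.sum_le_sum fun k hk =>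
    hω.exp_mul_cycleCapital_le hψ hq (Finset.mem_range.1 hk) hn).trans ?_
  rw [← Finset.mul_sum, Finset.sum_add_distrib, ← Finset.mul_sum, Finset.sum_const,
    Finset.card_range, nsmul_eq_mul]
  gcongr
  exact hG _ _

/-! ### Selling in all cycles -/

/-- The bets that sell the exponential capitals of the `q`-th cycle of the `m`-th level. -/
noncomputable def sellBet (ψ : ℝ → ℝ) (m q : ℕ) : Path → ℕ → ℝ :=
  mixtureBet (Finset.range (m + 1)) (fun _ => -Real.exp (-(m + 1) / 2)) fun k =>
    expBet (cycleFraction ψ m q k) (cycleStart ψ m q) (16 * cycleGridPoint ψ m q k)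

/-- The cycles of the levels `m₀ ≤ m < M`. -/
noncomputable def cycles (ψ : ℝ → ℝ) (m₀ M : ℕ) : Finset (Σ _ : ℕ, ℕ) :=
  (Finset.Ico m₀ M).sigma fun m => Finset.range (cycleCount ψ m)

/-- The range of values of `A²` during a cycle. -/
def cycleInterval (ψ : ℝ → ℝ) (p : Σ _ : ℕ, ℕ) : Set ℝ :=
  Set.Ico (cycleStart ψ p.1 p.2) (cycleStart ψ p.1 (p.2 + 1))

/-- The bets that sell, at the scale `ε`, in all cycles of the levels `m₀ ≤ m < M`. -/
noncomputable def lowerBet (ψ : ℝ → ℝ) (ε : ℝ) (m₀ M : ℕ) : Path → ℕ → ℝ :=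
  mixtureBet (cycles ψ m₀ M) (fun _ => ε) fun p => sellBet ψ p.1 p.2

lemma mem_cycles {p : Σ _ : ℕ, ℕ} :
    p ∈ cycles ψ m₀ M ↔ (m₀ ≤ p.1 ∧ p.1 < M) ∧ p.2 < cycleCount ψ p.1 := by
  rw [cycles, Finset.mem_sigma, Finset.mem_Ico, Finset.mem_range]

lemma predictable_lowerBet (ψ : ℝ → ℝ) (ε : ℝ) (m₀ M : ℕ) : Predictable (lowerBet ψ ε m₀ M) :=
  Predictable.mixtureBet fun _ => Predictable.mixtureBet fun _ => predictable_expBet _ _ _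

lemma wealth_sellBet (ψ : ℝ → ℝ) (m q : ℕ) (ω : Path) (n : ℕ) :
    wealth 1 (sellBet ψ m q) ω n = 1 + (cycleCost m - cycleDebt ψ m q ω n) := by
  rw [sellBet, wealth_mixtureBet, cycleCost_eq_sum, cycleDebt, ← Finset.sum_sub_distrib]
  simp only [wealth_expBet, cycleCapital]
  exact congrArg (1 + ·) (Finset.sum_congr rfl fun k _ => by ring)

lemma wealth_lowerBet (ψ : ℝ → ℝ) (ε : ℝ) (m₀ M : ℕ) (ω : Path) (n : ℕ) :
    wealth 1 (lowerBet ψ ε m₀ M) ω n =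
      1 + ε * ∑ p ∈ cycles ψ m₀ M, (cycleCost p.1 - cycleDebt ψ p.1 p.2 ω n) := by
  simp only [lowerBet, wealth_mixtureBet, wealth_sellBet, add_sub_cancel_left, Finset.mul_sum]

lemma LargeLevel.abs_sellBet_mul_c_le (hm : LargeLevel C m) (hψ : Tendsto ψ atTop atTop)
    (q : ℕ) (ω : Path) (n : ℕ) : |sellBet ψ m q ω n| * ω.c n ≤
      (cycleInterval ψ ⟨m, q⟩).indicator (fun _ => cycleDebt ψ m q ω n / 2) (ω.Asq n) := by
  refine (abs_mixtureBet_mul_c_le _ _ _ _ _).trans ?_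
  by_cases h : ω.Asq n ∈ cycleInterval ψ ⟨m, q⟩
  · rw [Set.indicator_of_mem h, cycleDebt, Finset.sum_div]
    refine Finset.sum_le_sum fun k _ => ?_
    rw [abs_neg, abs_of_pos (Real.exp_pos _), mul_div_assoc]
    exact mul_le_mul_of_nonneg_left (abs_expBet_mul_c_le _ _ _ _ _) (Real.exp_pos _).le
  · rw [Set.indicator_of_notMem h]
    refine (Finset.sum_eq_zero fun k hk => ?_).le
    have outside : ω.Asq n < cycleStart ψ m q ∨ 16 * cycleGridPoint ψ m q k ≤ ω.Asq n := by
      by_contra! h'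
      refine h ⟨h'.1, h'.2.trans ?_⟩
      linarith [hm.mul_cycleGridPoint_lt hψ q (Finset.mem_range.1 hk), cycleGridPoint_pos hψ m q k]
    rw [expBet_eq_zero outside, abs_zero, zero_mul, mul_zero]

lemma eq_of_mem_cycleInterval (hψ : Tendsto ψ atTop atTop) {p p' : Σ _ : ℕ, ℕ}
    (hp : p.2 < cycleCount ψ p.1) (hp' : p'.2 < cycleCount ψ p'.1)
    (h : l ∈ cycleInterval ψ p) (h' : l ∈ cycleInterval ψ p') : p = p' := by
  have level_le {m m' q q' : ℕ} (hq : q < cycleCount ψ m) (hlt : l < cycleStart ψ m (q + 1))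
      (hle : cycleStart ψ m' q' ≤ l) : m' ≤ m := by
    by_contra! hm
    exact (hlt.trans_le (cycleStart_succ_le_threshold hψ hq)).not_ge
      ((threshold_mono hψ hm).trans ((threshold_le_cycleStart hψ m' q').trans hle))
  have index_le {m q q' : ℕ} (hlt : l < cycleStart ψ m (q + 1)) (hle : cycleStart ψ m q' ≤ l) :
      q' ≤ q :=
    Nat.le_of_lt_succ ((cycleStart_mono hψ m).reflect_lt (hle.trans_lt hlt))
  obtain ⟨m, q⟩ := p
  obtain ⟨m', q'⟩ := p'
  obtain rfl : m = m' := le_antisymm (level_le hp' h'.2 h.1) (level_le hp h.2 h'.1)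
  obtain rfl : q = q' := le_antisymm (index_le h'.2 h.1) (index_le h.2 h'.1)
  rfl

lemma sum_indicator_cycleInterval_le (hψ : Tendsto ψ atTop atTop) (m₀ M : ℕ) (l : ℝ)
    (hB : 0 ≤ B) : ∑ p ∈ cycles ψ m₀ M, (cycleInterval ψ p).indicator (fun _ => B) l ≤ B := by
  classical
  simp only [Set.indicator_apply]
  rw [← Finset.sum_filter, Finset.sum_const, nsmul_eq_mul]
  refine mul_le_of_le_one_left hB (Nat.cast_le_one.2 (Finset.card_le_one.2 fun p hp p' hp' => ?_))
  rw [Finset.mem_filter, mem_cycles] at hp hp'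
  exact eq_of_mem_cycleInterval hψ hp.1.2 hp'.1.2 hp.2 hp'.2

lemma LowerPath.neg_indicator_le (hω : LowerPath ψ C n₀ m ω) (hψ : IsBarrier ψ)
    (hB : CycleDebtBound ψ C B) (hq : q < cycleCount ψ m) (n : ℕ) :
    -(cycleInterval ψ ⟨m, q⟩).indicator (fun _ => B) (ω.Asq n) ≤
      cycleCost m - cycleDebt ψ m q ω n := by
  have cost_nonneg := cycleCost_nonneg m
  rcases lt_or_ge (ω.Asq n) (cycleStart ψ m q) with before | started
  · rw [Set.indicator_of_notMem fun h => before.not_ge h.1, cycleDebt_eq_cycleCost before,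
      neg_zero, sub_self]
  · rcases lt_or_ge (ω.Asq n) (cycleStart ψ m (q + 1)) with during | after
    · rw [Set.indicator_of_mem (show _ ∈ cycleInterval ψ ⟨m, q⟩ from ⟨started, during⟩)]
      linarith [hB hω hq started]
    · rw [Set.indicator_of_notMem fun h => after.not_gt h.2]
      linarith [hω.cycleDebt_le_half_cycleCost hψ hq after]

lemma half_le_wealth_lowerBet (hψ : IsBarrier ψ) (hB0 : 0 < B) (hB : CycleDebtBound ψ C B)
    (hω : ∀ m ≥ m₀, LowerPath ψ C n₀ m ω) (M n : ℕ) :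
    1 / 2 ≤ wealth 1 (lowerBet ψ (1 / (2 * B)) m₀ M) ω n := by
  have neg_B_le : -B ≤ ∑ p ∈ cycles ψ m₀ M, (cycleCost p.1 - cycleDebt ψ p.1 p.2 ω n) := by
    refine (neg_le_neg (sum_indicator_cycleInterval_le hψ.tendsto m₀ M (ω.Asq n) hB0.le)).trans ?_
    rw [← Finset.sum_neg_distrib]
    refine Finset.sum_le_sum fun p hp => ?_
    obtain ⟨⟨hm, -⟩, hq⟩ := mem_cycles.1 hp
    exact (hω _ hm).neg_indicator_le hψ hB hq n
  have scaled := mul_le_mul_of_nonneg_left neg_B_le (by positivity : 0 ≤ 1 / (2 * B))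
  have neg_half : 1 / (2 * B) * -B = -(1 / 2) := by field_simp
  rw [wealth_lowerBet]
  linarith

lemma prudentAt_lowerBet (hψ : IsBarrier ψ) (hB0 : 0 < B) (hB : CycleDebtBound ψ C B)
    (hω : ∀ m ≥ m₀, LowerPath ψ C n₀ m ω) (M n : ℕ) :
    PrudentAt 1 (lowerBet ψ (1 / (2 * B)) m₀ M) ω n := by
  refine le_trans ?_ (half_le_wealth_lowerBet hψ hB0 hB hω M n)
  refine (abs_mixtureBet_mul_c_le _ _ _ _ _).trans (le_trans (Finset.sum_le_sum fun p hp => ?_)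
    (sum_indicator_cycleInterval_le hψ.tendsto m₀ M (ω.Asq n) one_half_pos.le))
  obtain ⟨⟨hm, -⟩, hq⟩ := mem_cycles.1 hp
  rw [abs_of_pos (by positivity)]
  refine (mul_le_mul_of_nonneg_left
    ((hω _ hm).abs_sellBet_mul_c_le hψ.tendsto p.2 ω n) (by positivity)).trans ?_
  by_cases h : ω.Asq n ∈ cycleInterval ψ p
  · rw [Set.indicator_of_mem h, Set.indicator_of_mem h, one_div_mul_eq_div,
      div_le_iff₀ (by positivity)]
    linarith [hB (hω _ hm) hq h.1]
  · rw [Set.indicator_of_notMem h, Set.indicator_of_notMem h, mul_zero]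

lemma reaches_lowerBet (hψ : IsBarrier ψ) (hB0 : 0 < B) (hB : CycleDebtBound ψ C B)
    (hω : ∀ m ≥ m₀, LowerPath ψ C n₀ m ω) (hA : Tendsto ω.Asq atTop atTop) {T : ℝ}
    (hT : 4 * B * T ≤ ∑ m ∈ Finset.Ico m₀ M, cycleCount ψ m * cycleCost m) :
    Reaches T (lowerBet ψ (1 / (2 * B)) m₀ M) ω := by
  obtain ⟨n, hn⟩ := (hA.eventually_ge_atTop (threshold ψ M)).exists
  refine ⟨n, ?_, fun i _ => prudentAt_lowerBet hψ hB0 hB hω M i⟩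
  have gain : ∑ m ∈ Finset.Ico m₀ M, cycleCount ψ m * cycleCost m / 2 ≤
      ∑ p ∈ cycles ψ m₀ M, (cycleCost p.1 - cycleDebt ψ p.1 p.2 ω n) := by
    rw [cycles, Finset.sum_sigma]
    refine Finset.sum_le_sum fun m hm => ?_
    obtain ⟨hm1, hm2⟩ := Finset.mem_Ico.1 hm
    have card_smul : cycleCount ψ m * cycleCost m / 2 =
        ∑ _q ∈ Finset.range (cycleCount ψ m), cycleCost m / 2 := by
      rw [Finset.sum_const, Finset.card_range, nsmul_eq_mul, mul_div_assoc]
    rw [card_smul]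
    refine Finset.sum_le_sum fun q hq => ?_
    have hq' := Finset.mem_range.1 hq
    have finished : cycleStart ψ m (q + 1) ≤ ω.Asq n :=
      (cycleStart_succ_le_threshold hψ.tendsto hq').trans
        ((threshold_mono hψ.tendsto hm2).trans hn)
    linarith [(hω m hm1).cycleDebt_le_half_cycleCost hψ hq' finished]
  rw [← Finset.sum_div] at gain
  have scaled := mul_le_mul_of_nonneg_left (show 2 * B * T ≤ _ by linarith)
    (by positivity : 0 ≤ 1 / (2 * B))
  rw [wealth_lowerBet]
  linarith [show 1 / (2 * B) * (2 * B * T) = T by field_simp]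

lemma TailBound.mono {C' : ℝ} {n₀' : ℕ} (h : TailBound ψ C n₀ ω) (hC : C ≤ C')
    (hn : n₀ ≤ n₀') : TailBound ψ C' n₀' ω where
  nonneg := h.nonneg.trans hC
  one_le_Asq i hi := h.one_le_Asq i (hn.trans hi)
  c_mul_pow_le i hi := (h.c_mul_pow_le i (hn.trans hi)).trans
    (mul_le_mul_of_nonneg_right hC (Real.sqrt_nonneg _))
  c_le i hi := h.c_le i (hn.trans hi)

lemma Regular.exists_eventually_lowerPath (h : Regular ψ ω) (hψ : IsBarrier ψ)
    (hS : ∀ᶠ n in atTop, ω.S n < ω.A n * ψ (ω.Asq n))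
    (hstart : ∀ᶠ m in atTop, CycleStartBound ψ m ω) :
    ∃ n₀, ∀ᶠ r : ℕ in atTop, ∀ m ≥ r, LargeLevel (r + 1) m → LowerPath ψ (r + 1) n₀ m ω := by
  obtain ⟨C, n₁, tailBound⟩ := h.exists_tailBound hψ
  obtain ⟨n₂, hn₂⟩ := eventually_atTop.1 hS
  refine ⟨max n₁ n₂, ?_⟩
  filter_upwards [tendsto_natCast_atTop_atTop.eventually_ge_atTop C,
    eventually_forall_ge_atTop.2 hstart, eventually_forall_ge_atTop.2
      (hψ.tendsto_threshold.eventually_gt_atTop (ω.Asq (max n₁ n₂)))] 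
    with r C_le startBound started m hm large
  exact
    { tailBound.mono (show C ≤ r + 1 by linarith) (le_max_left n₁ n₂), large with
      S_lt := fun n hn => hn₂ n ((le_max_right n₁ n₂).trans hn)
      started := started m hm
      startBound := startBound m hm }

theorem canForce_lower {α : ℝ} (hα : 0 < α) (hψ : IsBarrier ψ) (hI : integralI ψ = ⊤) :
    CanForce α fun ω => Regular ψ ω → ∃ᶠ n in atTop, ω.A n * ψ (ω.Asq n) ≤ ω.S n := by
  suffices h : CanForce (α / 2) fun ω => Regular ψ ω →
      (∀ᶠ m in atTop, CycleStartBound ψ m ω) → ∃ᶠ n in atTop, ω.A n * ψ (ω.Asq n) ≤ ω.S n from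
    add_halves α ▸ ((canForce_cycleStartBound (half_pos hα) hψ).and h).mono
      fun ω hω regular => hω.2 regular (hω.1 regular)
  have not_summable := not_summable_cycleCount_mul_cycleCost hψ.tendsto
    (hψ.not_summable_of_integralI_eq_top hI)
  choose B hB0 hB using fun r : ℕ => exists_cycleDebtBound hψ ((r : ℝ) + 1)
  choose m₀ hm₀ using fun r : ℕ => eventually_atTop.1
    ((eventually_largeLevel ((r : ℝ) + 1)).and (eventually_ge_atTop r))
  choose M hM using fun r : ℕ => exists_le_sum_Ico_of_not_summable
    (fun m => mul_nonneg (cycleCount ψ m).cast_nonneg (cycleCost_nonneg m)) not_summable (m₀ r)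
    (4 * B r * 4 ^ r)
  refine canForce_of_frequently_reaches (half_pos hα)
    (fun r => predictable_lowerBet ψ (1 / (2 * B r)) (m₀ r) (M r)) (v := fun r => (1 / 2) ^ r)
    (T := fun r => 4 ^ r) (fun r => by positivity) summable_geometric_two ?_ fun ω hω => ?_
  · refine (tendsto_pow_atTop_atTop_of_one_lt (one_lt_two (α := ℝ))).congr fun r => ?_
    rw [← mul_pow]
    norm_num
  · push Not at hω
    obtain ⟨regular, startBound, S_lt⟩ := hω
    obtain ⟨n₀, lowerPath⟩ := regular.exists_eventually_lowerPath hψ S_lt startBound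
    exact (lowerPath.mono fun r hr => reaches_lowerBet hψ (hB0 r) (hB r)
      (fun m hm => hr m (hm₀ r m hm).2 (hm₀ r m hm).1) regular.1 (hM r)).frequently

end Lower

end SPUFG

theorem theorem2 (α : ℝ) (hα : 0 < α) (ψ : ℝ → ℝ)
    (hcont : ContinuousOn ψ (Set.Ici 1)) (hmono : MonotoneOn ψ (Set.Ici 1))
    (hpos : ∀ t ∈ Set.Ici (1 : ℝ), 0 < ψ t) :
    (SPUFG.integralI ψ < ⊤ →
      SPUFG.CanForce α (fun ω => SPUFG.Regular ψ ω →
        ∀ᶠ n in Filter.atTop, ω.S n < ω.A n * ψ (ω.Asq n))) ∧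
    (SPUFG.integralI ψ = ⊤ → Filter.Tendsto ψ Filter.atTop Filter.atTop →
      SPUFG.CanForce α (fun ω => SPUFG.Regular ψ ω →
        ∃ᶠ n in Filter.atTop, ω.A n * ψ (ω.Asq n) ≤ ω.S n)) :=
  ⟨fun hI => SPUFG.canForce_upper hα
    ⟨hcont, hmono, hpos, SPUFG.tendsto_atTop_of_integralI_lt_top hmono hpos hI⟩ hI,
   fun hI hψ => SPUFG.canForce_lower hα ⟨hcont, hmono, hpos, hψ⟩ hI⟩
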